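/- Let $\Omega$ be a finite set with $d$ elements and let $P=(P_{ij})_{i,j\in\Omega}$ be a stochastic matrix (i.e. $P_{ij}\ge 0$ and $\sum_{j}P_{ij}=1$ for every $i$) which is irreducible: for all $i,j\in\Omega$ there is a path from $i$ to $j$ in the directed graph with edges $\{(k,l): P_{kl}>0\}$. For $n\ge 0$ let $\mathrm{Arv}(P)_n$ be the space of complex $\Omega\times\Omega$ matrices $A$ with $A_{ij}=0$ whenever $(P^n)_{ij}=0$. It is a Hilbert C*-correspondence over $\ell^\infty(\Omega)$, which acts on the left and on the right by multiplication by diagonal matrices, with inner product $\langle A,B\rangle=\mathrm{Diag}(A^*B)$. For $A\in \mathrm{Arv}(P)_n$ and $B\in\mathrm{Arv}(P)_m$ let $U_{n,m}(A\otimes B)\in \mathrm{Arv}(P)_{n+m}$ be the matrix with entries $$U_{n,m}(A\otimes B)_{ij}=\big((P^{n+m})_{ij}\big)^{-1/2}\sum_{k\in\Omega}\sqrt{(P^n)_{ik}}\,A_{ik}\,\sqrt{(P^m)_{kj}}\,B_{kj}$$ if $(P^{n+m})_{ij}>0$, and $0$ otherwise; these are the maps of the Arveson–Stinespring subproduct system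 of $P$. Let $\mathcal F=\bigoplus_{n\ge 0}\mathrm{Arv}(P)_n$ be the Hilbert C*-module direct sum, $\mathcal L(\mathcal F)$ the C*-algebra of adjointable operators on $\mathcal F$, and $Q_n\in\mathcal L(\mathcal F)$ the projection onto the $n$-th summand. For $A\in\mathrm{Arv}(P)_n$ let $S^{(n)}_A\in\mathcal L(\mathcal F)$ be the shift with $S^{(n)}_A(B)=U_{n,m}(A\otimes B)$ for $B\in\mathrm{Arv}(P)_m$, $m\ge 0$. Let $\mathcal T(P)\subseteq \mathcal L(\mathcal F)$ be the C*-subalgebra generated by the left action of $\ell^\infty(\Omega)$ and all the shifts $S^{(n)}_A$, let $\mathcal J(\mathcal T(P))=\{T\in\mathcal T(P): \lim_{n\to\infty}\|TQ_n\|=0\}$, which is a closed two-sided ideal, and let $\mathcal O(P)=\mathcal T(P)/\mathcal J(\mathcal T(P))$ be the Cuntz–Pimsner algebra. Then $\mathcal O(P)$ is $*$-isomorphic to $M_d(\mathbb C)\otimes C(\mathbb T)$. -/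

import Mathlib

open Filter Topology
open scoped ComplexOrder TensorProduct

namespace CStarModule

section Adjointable

set_option linter.unusedSectionVars false

variable (A E : Type*) [CStarAlgebra A] [PartialOrder A] [StarOrderedRing A] [SMul A E]
  [NormedAddCommGroup E] [NormedSpace ℂ E] [CStarModule A E]

/-- The adjointable operators on a Hilbert C⋆-module `E` over `A`: the operators `T` for which there
is an operator `S` with `⟪T x, y⟫ = ⟪x, S y⟫` for all `x y`. -/
def adjointableSubalgebra : Subalgebra ℂ (E →L[ℂ] E) where
  carrier := {T | ∃ S : E →L[ℂ] E, ∀ x y, inner A (T x) y = inner A x (S y)}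
  mul_mem' := by
    rintro T₁ T₂ ⟨S₁, h₁⟩ ⟨S₂, h₂⟩
    exact ⟨S₂ * S₁, fun x y => by simp [h₁, h₂]⟩
  add_mem' := by
    rintro T₁ T₂ ⟨S₁, h₁⟩ ⟨S₂, h₂⟩
    exact ⟨S₁ + S₂, fun x y => by simp [h₁, h₂]⟩
  algebraMap_mem' z := ⟨algebraMap ℂ _ (star z), fun x y => by
    simp [Algebra.algebraMap_eq_smul_one]⟩

/-- The algebra `𝓛(E)` of adjointable operators on a Hilbert C⋆-module `E` over `A`, with the
operator norm and the involution `T ↦ T*`. -/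
def Adjointable : Type _ := adjointableSubalgebra A E

variable {A E}

theorem eq_of_forall_inner {x y : E} (h : ∀ z, inner A z x = inner A z y) : x = y := by
  rw [← sub_eq_zero, ← inner_self (A := A), inner_sub_right, h, sub_self]

namespace Adjointable

noncomputable instance : NormedRing (Adjointable A E) :=
  inferInstanceAs (NormedRing (adjointableSubalgebra A E))

noncomputable instance : NormedAlgebra ℂ (Adjointable A E) :=
  inferInstanceAs (NormedAlgebra ℂ (adjointableSubalgebra A E))

@[ext] theorem ext {S T : Adjointable A E} (h : ∀ x, S.1 x = T.1 x) : S = T :=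
  Subtype.ext (ContinuousLinearMap.ext h)

theorem add_apply (S T : Adjointable A E) (x : E) : (S + T).1 x = S.1 x + T.1 x := rfl

theorem mul_apply (S T : Adjointable A E) (x : E) : (S * T).1 x = S.1 (T.1 x) := rfl

theorem smul_apply (z : ℂ) (T : Adjointable A E) (x : E) : (z • T).1 x = z • T.1 x := rfl

/-- The adjoint of an adjointable operator. -/
noncomputable instance : Star (Adjointable A E) where
  star T := ⟨T.2.choose, T.1, fun x y => by
    rw [← star_inner, ← T.2.choose_spec, star_inner]⟩

theorem inner_apply_left (T : Adjointable A E) (x y : E) :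
    inner A (T.1 x) y = inner A x ((star T).1 y) := T.2.choose_spec x y

theorem inner_apply_right (T : Adjointable A E) (x y : E) :
    inner A x (T.1 y) = inner A ((star T).1 x) y := by
  rw [← star_inner, inner_apply_left, star_inner]

theorem star_eq {T : Adjointable A E} {S : E →L[ℂ] E}
    (h : ∀ x y, inner A (T.1 x) y = inner A x (S y)) : (star T).1 = S := by
  ext y
  exact eq_of_forall_inner (A := A) fun z => by rw [← inner_apply_left, h]

noncomputable instance : StarRing (Adjointable A E) where
  star_involutive T := Subtype.ext <| star_eq fun x y => (inner_apply_right T x y).symm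
  star_mul T S := Subtype.ext <| star_eq fun x y => by
    simp [mul_apply, inner_apply_left]
  star_add T S := Subtype.ext <| star_eq fun x y => by
    simp [add_apply, inner_apply_left]

instance : StarModule ℂ (Adjointable A E) where
  star_smul z T := Subtype.ext <| star_eq fun x y => by
    simp [smul_apply, inner_apply_left]

instance : CStarRing (Adjointable A E) where
  norm_mul_self_le T := by
    suffices h : ‖T.1‖ ≤ √‖(star T * T).1‖ by
      have := mul_self_le_mul_self (norm_nonneg _) h
      rwa [Real.mul_self_sqrt (norm_nonneg _)] at this
    refine ContinuousLinearMap.opNorm_le_bound _ (Real.sqrt_nonneg _) fun x => ?_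
    refine le_of_sq_le_sq ?_ (by positivity)
    rw [norm_sq_eq A, inner_apply_left, mul_pow, Real.sq_sqrt (norm_nonneg _)]
    refine (norm_inner_le E).trans ?_
    have := ((star T * T).1).le_opNorm x
    have h2 : ((star T).1 (T.1 x)) = (star T * T).1 x := rfl
    rw [h2]
    calc ‖x‖ * ‖(star T * T).1 x‖ ≤ ‖x‖ * (‖(star T * T).1‖ * ‖x‖) := by gcongr
      _ = ‖(star T * T).1‖ * ‖x‖ ^ 2 := by ring

instance [CompleteSpace E] : CompleteSpace (Adjointable A E) := by
  refine Metric.complete_of_cauchySeq_tendsto fun u hu => ?_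
  have h1 : CauchySeq fun n => (u n).1 := hu.map uniformContinuous_subtype_val
  have h2 : CauchySeq fun n => (star (u n)).1 :=
    (hu.map (starₗᵢ ℂ (E := Adjointable A E)).isometry.uniformContinuous).map
      uniformContinuous_subtype_val
  obtain ⟨T, hT⟩ := cauchySeq_tendsto_of_complete h1
  obtain ⟨S, hS⟩ := cauchySeq_tendsto_of_complete h2
  refine ⟨⟨T, S, fun x y => ?_⟩, tendsto_subtype_rng.2 hT⟩
  have hTx : Tendsto (fun n => (u n).1 x) atTop (𝓝 (T x)) :=
    ((ContinuousLinearMap.apply ℂ E x).continuous.tendsto T).comp hT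
  have hSy : Tendsto (fun n => (star (u n)).1 y) atTop (𝓝 (S y)) :=
    ((ContinuousLinearMap.apply ℂ E y).continuous.tendsto S).comp hS
  have a := ((continuous_inner (A := A) (E := E)).tendsto (T x, y)).comp
    (hTx.prodMk_nhds tendsto_const_nhds)
  have b := ((continuous_inner (A := A) (E := E)).tendsto (x, S y)).comp
    ((tendsto_const_nhds (x := x)).prodMk_nhds hSy)
  refine tendsto_nhds_unique a (b.congr fun n => ?_)
  simp [inner_apply_left]

noncomputable instance [CompleteSpace E] : CStarAlgebra (Adjointable A E) where

end Adjointable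
end Adjointable
end CStarModule

/-- A norm-closed two-sided ideal of a C⋆-algebra is self-adjoint. -/
theorem Ideal.star_mem_of_isClosed {B : Type*} [CStarAlgebra B] (I : Ideal B) [I.IsTwoSided]
    (hI : IsClosed (I : Set B)) {x : B} (hx : x ∈ I) : star x ∈ I := by
  let _ := CStarAlgebra.spectralOrder B
  have := CStarAlgebra.spectralOrderedRing B
  have hsp : ∀ t ∈ spectrum ℝ (x * star x), 0 ≤ t := fun t ht =>
    spectrum_nonneg_of_nonneg (mul_star_self_nonneg x) ht
  have hsa : IsSelfAdjoint (x * star x) := .mul_star_self x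
  have key : ∀ ε > 0, ∃ y ∈ I, ‖star x - y‖ ^ 2 ≤ ε := by
    intro ε hε
    set h := x * star x with hh
    have hne : ∀ t ∈ spectrum ℝ h, t + ε ≠ 0 := fun t ht => by linarith [hsp t ht]
    have hc : ContinuousOn (fun t : ℝ => (t + ε)⁻¹) (spectrum ℝ h) :=
      ContinuousOn.inv₀ (by fun_prop) hne
    set g := cfc (fun t : ℝ => (t + ε)⁻¹) h with hg
    have hgs : IsSelfAdjoint g := cfc_predicate _ _
    refine ⟨star x * (g * h), I.mul_mem_left _ (I.mul_mem_left _ (I.mul_mem_right _ hx)), ?_⟩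
    have e1 : 1 - g * h = cfc (fun t : ℝ => 1 - (t + ε)⁻¹ * t) h := by
      rw [cfc_sub (fun _ => (1 : ℝ)) (fun t : ℝ => (t + ε)⁻¹ * t) h (by fun_prop)
        (hc.mul continuousOn_id), cfc_const_one ℝ h, cfc_mul _ _ h hc (by fun_prop), cfc_id' ℝ h]
    have hs1 : IsSelfAdjoint (1 - g * h) := e1 ▸ cfc_predicate _ _
    have hc1 : ContinuousOn (fun t : ℝ => 1 - (t + ε)⁻¹ * t) (spectrum ℝ h) :=
      continuousOn_const.sub (hc.mul continuousOn_id)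
    have e2 : star x - star x * (g * h) = star x * (1 - g * h) := by noncomm_ring
    rw [e2, pow_two, ← CStarRing.norm_star_mul_self]
    have e3 : star (star x * (1 - g * h)) * (star x * (1 - g * h))
        = cfc (fun t : ℝ => (1 - (t + ε)⁻¹ * t) * (t * (1 - (t + ε)⁻¹ * t))) h := by
      rw [cfc_mul _ (fun t : ℝ => t * (1 - (t + ε)⁻¹ * t)) h hc1 (continuousOn_id.mul hc1),
        cfc_mul (fun t : ℝ => t) _ h continuousOn_id hc1, cfc_id' ℝ h, ← e1,
        star_mul, star_star, hs1.star_eq, hh]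
      noncomm_ring
    rw [e3]
    refine norm_cfc_le hε.le fun t ht => ?_
    have h0 := hsp t ht
    have hp : 0 < t + ε := by linarith
    have : (1 - (t + ε)⁻¹ * t) * (t * (1 - (t + ε)⁻¹ * t)) = ε * (ε / (t + ε)) * (t / (t + ε)) := by
      field_simp
      ring
    rw [this, Real.norm_of_nonneg (by positivity), mul_assoc]
    refine mul_le_of_le_one_right hε.le (mul_le_one₀ ?_ (by positivity) ?_)
    · rw [div_le_one hp]; linarith
    · rw [div_le_one hp]; linarith
  refine hI.closure_subset (Metric.mem_closure_iff.2 fun δ hδ => ?_)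
  obtain ⟨y, hy, hle⟩ := key ((δ / 2) ^ 2) (by positivity)
  refine ⟨y, hy, ?_⟩
  rw [dist_eq_norm]
  linarith [abs_le.1 (abs_le_of_sq_le_sq hle (by positivity))|>.2]

/-! ### The subproduct system of a stochastic matrix and its Fock module -/

namespace StochasticMatrix

open CStarModule Matrix

set_option linter.unusedSectionVars false

variable {Ω : Type*} [Fintype Ω] [DecidableEq Ω]

/-- The `n`-th fibre `Arv(P)_n`: the complex matrices supported in the set of edges
`E(P ^ n) = {(i, j) | (P ^ n) i j > 0}`. -/
def Arv (P : rowStochastic ℝ Ω) (n : ℕ) : Submodule ℂ (Matrix Ω Ω ℂ) where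
  carrier := {A | ∀ i j, ¬ 0 < ((P : Matrix Ω Ω ℝ) ^ n) i j → A i j = 0}
  add_mem' hA hB i j h := by simp [hA i j h, hB i j h]
  zero_mem' _ _ _ := rfl
  smul_mem' z A hA i j h := by simp [hA i j h]

/-- The `ℓ^∞(Ω)`-valued inner product `⟨A, B⟩ = Diag (A* B)` of a fibre. -/
def fibreInner (A B : Matrix Ω Ω ℂ) : Ω → ℂ := (Aᴴ * B).diag

/-- The entrywise square root `√Q`. -/
noncomputable def entrySqrt (Q : Matrix Ω Ω ℝ) : Matrix Ω Ω ℝ := of fun i j => √(Q i j)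

/-- The matrix `Q^♭` of inverses of the positive entries. -/
noncomputable def flat (Q : Matrix Ω Ω ℝ) : Matrix Ω Ω ℝ :=
  of fun i j => if 0 < Q i j then (Q i j)⁻¹ else 0

/-- A real matrix as a complex matrix. -/
def toComplex (Q : Matrix Ω Ω ℝ) : Matrix Ω Ω ℂ := of fun i j => (Q i j : ℂ)

/-- The subproduct maps
`U_{n,m}(A ⊗ B) = (√(P^{n+m}))^♭ * [(√(P^n) * A) ⬝ (√(P^m) * B)]`, where `*` is the entrywise
product. For `n = 0` or `m = 0` this is the left or right action of the diagonal matrices. -/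
noncomputable def subproductMul (P : rowStochastic ℝ Ω) (n m : ℕ) (A B : Matrix Ω Ω ℂ) :
    Matrix Ω Ω ℂ :=
  toComplex (flat (entrySqrt ((P : Matrix Ω Ω ℝ) ^ (n + m)))) ⊙
    ((toComplex (entrySqrt ((P : Matrix Ω Ω ℝ) ^ n)) ⊙ A) *
      (toComplex (entrySqrt ((P : Matrix Ω Ω ℝ) ^ m)) ⊙ B))

theorem subproductMul_mem (P : rowStochastic ℝ Ω) (n m : ℕ) (A B : Matrix Ω Ω ℂ) :
    subproductMul P n m A B ∈ Arv P (n + m) := by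
  intro i j h
  simp [subproductMul, toComplex, flat, entrySqrt, h]

section Fock

/-! #### Column sums of squares -/

/-- `∑ i, |A i j|²`, which is the `j`-th coordinate of `⟨A, A⟩`. -/
noncomputable def colSq (A : Matrix Ω Ω ℂ) (j : Ω) : ℝ := ∑ i, ‖A i j‖ ^ 2

theorem colSq_nonneg (A : Matrix Ω Ω ℂ) (j : Ω) : 0 ≤ colSq A j :=
  Finset.sum_nonneg fun _ _ => by positivity

theorem fibreInner_apply (A B : Matrix Ω Ω ℂ) (j : Ω) :
    fibreInner A B j = ∑ i, star (A i j) * B i j := by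
  simp [fibreInner, Matrix.mul_apply]

theorem fibreInner_self (A : Matrix Ω Ω ℂ) (j : Ω) : fibreInner A A j = (colSq A j : ℂ) := by
  rw [fibreInner_apply, colSq]
  push_cast
  exact Finset.sum_congr rfl fun i _ => by rw [Complex.star_def, Complex.conj_mul']

theorem norm_fibreInner_le (A B : Matrix Ω Ω ℂ) (j : Ω) :
    ‖fibreInner A B j‖ ≤ colSq A j + colSq B j := by
  rw [fibreInner_apply, colSq, colSq, ← Finset.sum_add_distrib]
  refine (norm_sum_le _ _).trans (Finset.sum_le_sum fun i _ => ?_)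
  rw [norm_mul, norm_star]
  nlinarith [sq_nonneg (‖A i j‖ - ‖B i j‖), sq_nonneg ‖A i j‖, sq_nonneg ‖B i j‖]

theorem colSq_add_le (A B : Matrix Ω Ω ℂ) (j : Ω) :
    colSq (A + B) j ≤ 2 * colSq A j + 2 * colSq B j := by
  simp only [colSq, Finset.mul_sum, ← Finset.sum_add_distrib]
  refine Finset.sum_le_sum fun i _ => ?_
  have := norm_add_le (A i j) (B i j)
  rw [Matrix.add_apply]
  nlinarith [sq_nonneg (‖A i j‖ - ‖B i j‖), norm_nonneg (A i j + B i j)]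

theorem colSq_smul (z : ℂ) (A : Matrix Ω Ω ℂ) (j : Ω) :
    colSq (z • A) j = ‖z‖ ^ 2 * colSq A j := by
  simp [colSq, Finset.mul_sum, mul_pow]

theorem summable_fibreInner_self {f : ℕ → Matrix Ω Ω ℂ} :
    (Summable fun n => fibreInner (f n) (f n)) ↔ ∀ j, Summable fun n => colSq (f n) j := by
  rw [Pi.summable]
  simp only [fibreInner_self, Complex.summable_ofReal]

variable (P : rowStochastic ℝ Ω)

/-- The sequences `x n ∈ Arv(P)_n` for which `∑ n, ⟨x n, x n⟩` converges in `ℓ^∞(Ω)`. -/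
def fockSubmodule : Submodule ℂ (∀ n, Arv P n) where
  carrier := {x | Summable fun n => fibreInner (x n).1 (x n).1}
  add_mem' {x y} hx hy := by
    simp only [Set.mem_ofPred_eq, summable_fibreInner_self] at *
    exact fun j => .of_nonneg_of_le (fun n => colSq_nonneg _ _) (fun n => colSq_add_le _ _ _)
      (((hx j).mul_left 2).add ((hy j).mul_left 2))
  zero_mem' := by simp [fibreInner, summable_zero]
  smul_mem' z x hx := by
    simp only [Set.mem_ofPred_eq, summable_fibreInner_self] at *
    exact fun j => ((hx j).mul_left (‖z‖ ^ 2)).congr fun n => (colSq_smul _ _ _).symm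

/-- The Fock module `⨁ n, Arv(P)_n`, the direct sum of Hilbert C⋆-modules over `ℓ^∞(Ω)`. -/
def Fock : Type _ := fockSubmodule P

namespace Fock

variable {P}

instance : AddCommGroup (Fock P) := inferInstanceAs (AddCommGroup (fockSubmodule P))

instance : Module ℂ (Fock P) := inferInstanceAs (Module ℂ (fockSubmodule P))

/-- The `n`-th component of a vector of the Fock module, as a matrix. -/
def comp (x : Fock P) (n : ℕ) : Matrix Ω Ω ℂ := (x.1 n).1

@[ext] theorem ext {x y : Fock P} (h : ∀ n, x.comp n = y.comp n) : x = y :=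
  Subtype.ext <| funext fun n => Subtype.ext (h n)

@[simp] theorem comp_add (x y : Fock P) (n : ℕ) : (x + y).comp n = x.comp n + y.comp n := rfl

@[simp] theorem comp_sub (x y : Fock P) (n : ℕ) : (x - y).comp n = x.comp n - y.comp n := rfl

@[simp] theorem comp_zero (n : ℕ) : (0 : Fock P).comp n = 0 := rfl

@[simp] theorem comp_smul (z : ℂ) (x : Fock P) (n : ℕ) : (z • x).comp n = z • x.comp n := rfl

theorem comp_mem (x : Fock P) (n : ℕ) : x.comp n ∈ Arv P n := (x.1 n).2

theorem summable_colSq (x : Fock P) (j : Ω) : Summable fun n => colSq (x.comp n) j :=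
  summable_fibreInner_self.1 x.2 j

/-- Build a vector of the Fock module from its components. -/
def mk (f : ℕ → Matrix Ω Ω ℂ) (hf : ∀ n, f n ∈ Arv P n)
    (hs : ∀ j, Summable fun n => colSq (f n) j) : Fock P :=
  ⟨fun n => ⟨f n, hf n⟩, summable_fibreInner_self.2 hs⟩

@[simp] theorem comp_mk (f : ℕ → Matrix Ω Ω ℂ) (hf hs) (n : ℕ) :
    (mk f hf hs : Fock P).comp n = f n := rfl

theorem summable_fibreInner (x y : Fock P) :
    Summable fun n => fibreInner (x.comp n) (y.comp n) :=
  Pi.summable.2 fun j => .of_norm_bounded ((x.summable_colSq j).add (y.summable_colSq j))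
    fun _ => norm_fibreInner_le _ _ _

/-- The right action of `ℓ^∞(Ω)`: multiplication on the right by diagonal matrices in every fibre.
(Mathlib writes the module action on the left; `ℓ^∞(Ω)` is commutative.) -/
instance : SMul (Ω → ℂ) (Fock P) where
  smul a x := mk (fun n => x.comp n * diagonal a)
    (fun n i j h => by simp [x.comp_mem n i j h])
    (fun j => ((x.summable_colSq j).mul_left (‖a j‖ ^ 2)).congr fun n => by
      simp [colSq, Finset.mul_sum, mul_pow, mul_comm])

theorem comp_smul' (a : Ω → ℂ) (x : Fock P) (n : ℕ) : (a • x).comp n = x.comp n * diagonal a := rfl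

/-- The inner product `⟨x, y⟩ = ∑ n, ⟨x n, y n⟩`. -/
noncomputable instance : Inner (Ω → ℂ) (Fock P) where
  inner x y := ∑' n, fibreInner (x.comp n) (y.comp n)

theorem inner_def (x y : Fock P) :
    inner (Ω → ℂ) x y = ∑' n, fibreInner (x.comp n) (y.comp n) := rfl

theorem inner_apply (x y : Fock P) (j : Ω) :
    inner (Ω → ℂ) x y j = ∑' n, fibreInner (x.comp n) (y.comp n) j := by
  rw [inner_def, tsum_apply (summable_fibreInner x y)]

/-- `∑ n i, |x n i j|²`, which is the `j`-th coordinate of `⟨x, x⟩`. -/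
noncomputable def totSq (x : Fock P) (j : Ω) : ℝ := ∑' n, colSq (x.comp n) j

theorem totSq_nonneg (x : Fock P) (j : Ω) : 0 ≤ x.totSq j := tsum_nonneg fun _ => colSq_nonneg _ _

theorem inner_self_apply (x : Fock P) (j : Ω) : inner (Ω → ℂ) x x j = (x.totSq j : ℂ) := by
  simp only [inner_apply, fibreInner_self, totSq, Complex.ofReal_tsum]

noncomputable instance : Norm (Fock P) := CStarModule.norm (Ω → ℂ)

noncomputable instance : CStarModule (Ω → ℂ) (Fock P) where
  inner_add_right {x y z} := by
    simp only [inner_def, ← (summable_fibreInner x y).tsum_add (summable_fibreInner x z)]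
    congr! 2 with n
    simp [fibreInner, mul_add]
  inner_self_nonneg {x} := fun j => by
    rw [inner_self_apply]
    exact Complex.zero_le_real.2 (x.totSq_nonneg j)
  inner_self {x} := by
    refine ⟨fun h => ?_, fun h => ?_⟩
    · ext n i j
      have h1 : x.totSq j = 0 := Complex.ofReal_eq_zero.1 <|
        (inner_self_apply x j).symm.trans (congrFun h j)
      have h2 := congrFun ((hasSum_zero_iff_of_nonneg fun n => colSq_nonneg (x.comp n) j).1
        ((x.summable_colSq j).hasSum_iff.2 h1)) n
      have h3 := (Finset.sum_eq_zero_iff_of_nonneg fun i _ => by positivity).1 h2 i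
        (Finset.mem_univ i)
      simpa using h3
    · subst h
      simp [inner_def, fibreInner, Pi.zero_def]
  inner_op_smul_right {a x y} := by
    ext j
    simp only [inner_apply, Pi.mul_apply, ← tsum_mul_left]
    congr! 2 with n
    simp only [fibreInner_apply, comp_smul', mul_diagonal, Finset.mul_sum]
    exact Finset.sum_congr rfl fun i _ => by ring
  inner_smul_right_complex {z x y} := by
    ext j
    simp only [inner_apply, Pi.smul_apply, smul_eq_mul, ← tsum_mul_left]
    congr! 2 with n
    simp only [fibreInner_apply, comp_smul, Matrix.smul_apply, smul_eq_mul, Finset.mul_sum]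
    exact Finset.sum_congr rfl fun i _ => by ring
  star_inner x y := by
    ext j
    simp only [Pi.star_apply, inner_apply]
    rw [tsum_star]
    congr! 2 with n
    simp [fibreInner_apply, mul_comm]
  norm_eq_sqrt_norm_inner_self _ := rfl

noncomputable instance : NormedAddCommGroup (Fock P) := CStarModule.normedAddCommGroup (Ω → ℂ)

noncomputable instance : NormedSpace ℂ (Fock P) := .ofCore (CStarModule.normedSpaceCore (Ω → ℂ))

theorem norm_le_iff (x : Fock P) {r : ℝ} (hr : 0 ≤ r) : ‖x‖ ≤ r ↔ ∀ j, x.totSq j ≤ r ^ 2 := by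
  rw [CStarModule.norm_eq_sqrt_norm_inner_self (A := Ω → ℂ) x, Real.sqrt_le_left hr,
    pi_norm_le_iff_of_nonneg (by positivity)]
  refine forall_congr' fun j => ?_
  rw [inner_self_apply, Complex.norm_real, Real.norm_of_nonneg (x.totSq_nonneg j)]

/-- The columns of a vector of the Fock module, as square summable families. -/
noncomputable def toLp (x : Fock P) (j : Ω) : lp (fun _ : ℕ × Ω => ℂ) 2 :=
  ⟨fun p => x.comp p.1 p.2 j, (memℓp_gen_iff (by simp)).2 <| by
    rw [summable_prod_of_nonneg fun p => by positivity]
    refine ⟨fun n => (hasSum_fintype _).summable, ?_⟩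
    simpa [tsum_fintype, colSq] using x.summable_colSq j⟩

theorem norm_toLp_sq (x : Fock P) (j : Ω) : ‖x.toLp j‖ ^ 2 = x.totSq j := by
  have h := lp.norm_rpow_eq_tsum (p := 2) (by simp) (x.toLp j)
  have hs := (memℓp_gen_iff (by simp)).1 (x.toLp j).2
  rw [hs.tsum_prod] at h
  simpa [tsum_fintype, totSq, colSq, toLp] using h

theorem norm_toLp (x : Fock P) : ‖x.toLp‖ = ‖x‖ := by
  refine le_antisymm ?_ ?_
  · refine (pi_norm_le_iff_of_nonneg (norm_nonneg x)).2 fun j => ?_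
    refine le_of_sq_le_sq ?_ (norm_nonneg x)
    rw [norm_toLp_sq]
    exact (norm_le_iff x (norm_nonneg x)).1 le_rfl j
  · refine (norm_le_iff x (norm_nonneg _)).2 fun j => ?_
    rw [← norm_toLp_sq]
    gcongr
    exact norm_le_pi_norm x.toLp j

theorem isometry_toLp : Isometry (toLp : Fock P → Ω → lp (fun _ : ℕ × Ω => ℂ) 2) := by
  refine Isometry.of_dist_eq fun x y => ?_
  rw [dist_eq_norm, dist_eq_norm, ← norm_toLp]
  rfl

theorem range_toLp : Set.range (toLp : Fock P → Ω → lp (fun _ : ℕ × Ω => ℂ) 2) =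
    ⋂ (n : ℕ) (i : Ω) (j : Ω) (_ : ¬ 0 < ((P : Matrix Ω Ω ℝ) ^ n) i j), {f | f j (n, i) = 0} := by
  ext f
  simp only [Set.mem_range, Set.mem_iInter, Set.mem_ofPred_eq]
  refine ⟨?_, fun h => ?_⟩
  · rintro ⟨x, rfl⟩ n i j h
    exact x.comp_mem n i j h
  · refine ⟨mk (fun n => of fun i j => f j (n, i)) (fun n i j hn => h n i j hn) fun j => ?_, rfl⟩
    have hs := (memℓp_gen_iff (by simp)).1 (f j).2
    rw [summable_prod_of_nonneg fun p => by positivity] at hs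
    simpa [tsum_fintype, colSq] using hs.2

instance : CompleteSpace (Fock P) := by
  rw [completeSpace_iff_isComplete_range (isometry_toLp (P := P)).isUniformInducing, range_toLp]
  refine IsClosed.isComplete ?_
  refine isClosed_iInter fun n => isClosed_iInter fun i => isClosed_iInter fun j =>
    isClosed_iInter fun _ => isClosed_eq ?_ continuous_const
  exact (lp.evalCLM ℂ (fun _ : ℕ × Ω => ℂ) 2 (n, i)).continuous.comp (continuous_apply j)

/-! #### Operators given on the fibres -/

/-- A linear map on sequences which sends the fibre of degree `s k` to the fibre of degree `k` for
all `k ∈ D`, with a uniform bound; it restricts to a bounded operator on the Fock module. -/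
def IsBounded (T : (∀ n, Arv P n) →ₗ[ℂ] (∀ n, Arv P n)) : Prop :=
  ∃ (D : Set ℕ) (s : ℕ → ℕ) (C : ℝ), Set.InjOn s D ∧ 0 ≤ C ∧ (∀ x, ∀ k ∉ D, T x k = 0) ∧
    ∀ x, ∀ k ∈ D, ∀ j, colSq (T x k).1 j ≤ C * colSq (x (s k)).1 j

theorem summable_of_injOn {f g : ℕ → ℝ} (hf : ∀ k, 0 ≤ f k) (hg : ∀ k, 0 ≤ g k) (hgs : Summable g)
    {D : Set ℕ} {s : ℕ → ℕ} {C : ℝ} (hs : Set.InjOn s D) (hC : 0 ≤ C) (h0 : ∀ k ∉ D, f k = 0)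
    (hb : ∀ k ∈ D, f k ≤ C * g (s k)) : Summable f ∧ ∑' k, f k ≤ C * ∑' k, g k := by
  have hsupp : Function.support f ⊆ D := fun k hk => by
    by_contra hkD
    exact hk (h0 k hkD)
  have hinj : Function.Injective fun k : D => s k := Set.injOn_iff_injective.1 hs
  have h1 : Summable fun k : D => C * g (s k) := (hgs.comp_injective hinj).mul_left C
  have h2 : Summable fun k : D => f k :=
    .of_nonneg_of_le (fun k : D => hf k) (fun k : D => hb k.1 k.2) h1
  refine ⟨?_, ?_⟩
  · have := summable_subtype_iff_indicator.1 h2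
    rwa [Set.indicator_eq_self.2 hsupp] at this
  · rw [← tsum_subtype_eq_of_support_subset hsupp]
    refine (h2.tsum_le_tsum (fun k : D => hb k k.2) h1).trans ?_
    rw [tsum_mul_left]
    gcongr
    exact tsum_comp_le_tsum_of_inj hgs hg hinj

theorem IsBounded.bound {T : (∀ n, Arv P n) →ₗ[ℂ] (∀ n, Arv P n)} (hT : IsBounded T) :
    ∃ C : ℝ, 0 ≤ C ∧ ∀ x : Fock P, ∀ j, (Summable fun k => colSq (T x.1 k).1 j) ∧
      ∑' k, colSq (T x.1 k).1 j ≤ C * x.totSq j := by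
  obtain ⟨D, s, C, hs, hC, h0, hb⟩ := hT
  refine ⟨C, hC, fun x j => summable_of_injOn (fun k => colSq_nonneg _ _)
    (fun k => colSq_nonneg _ _) (x.summable_colSq j) hs hC (fun k hk => ?_)
    fun k hk => hb x.1 k hk j⟩
  rw [h0 x.1 k hk]
  simp [colSq]

/-- The bounded operator on the Fock module given by a bounded map on sequences. -/
noncomputable def ofSeq (T : (∀ n, Arv P n) →ₗ[ℂ] (∀ n, Arv P n)) (hT : IsBounded T) :
    Fock P →L[ℂ] Fock P :=
  LinearMap.mkContinuousOfExistsBound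
    { toFun := fun x => mk (fun n => (T x.1 n).1) (fun n => (T x.1 n).2)
        fun j => (hT.bound.choose_spec.2 x j).1
      map_add' := fun x y => by
        have : (x + y).1 = x.1 + y.1 := rfl
        ext n : 1
        simp [this]
      map_smul' := fun z x => by
        have : (z • x).1 = z • x.1 := rfl
        ext n : 1
        simp [this] }
    (by
      obtain ⟨C, hC, h⟩ := hT.bound
      refine ⟨√C, fun x => (norm_le_iff _ (by positivity)).2 fun j => ?_⟩
      rw [mul_pow, Real.sq_sqrt hC]
      refine (h x j).2.trans ?_
      gcongr
      exact (norm_le_iff x (norm_nonneg x)).1 le_rfl j)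

@[simp] theorem comp_ofSeq (T : (∀ n, Arv P n) →ₗ[ℂ] (∀ n, Arv P n)) (hT : IsBounded T)
    (x : Fock P) (n : ℕ) : (ofSeq T hT x).comp n = (T x.1 n).1 := rfl

/-- The projection onto the `n`-th fibre, on sequences. -/
noncomputable def projSeq (n : ℕ) : (∀ n, Arv P n) →ₗ[ℂ] (∀ n, Arv P n) where
  toFun x k := if k = n then x k else 0
  map_add' x y := by ext k : 1; simp only [Pi.add_apply]; split_ifs <;> simp
  map_smul' z x := by ext k : 1; simp

theorem isBounded_projSeq (n : ℕ) : IsBounded (projSeq n : (∀ n, Arv P n) →ₗ[ℂ] _) :=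
  ⟨Set.univ, id, 1, Function.injective_id.injOn, zero_le_one, by simp, fun x k _ j => by
    by_cases h : k = n
    · simp [projSeq, h]
    · simpa [projSeq, h, colSq] using colSq_nonneg _ _⟩

theorem inner_projSeq (n : ℕ) (x y : Fock P) :
    inner (Ω → ℂ) (ofSeq (projSeq n) (isBounded_projSeq n) x) y =
      inner (Ω → ℂ) x (ofSeq (projSeq n) (isBounded_projSeq n) y) := by
  rw [inner_def, inner_def]
  refine tsum_congr fun k => ?_
  rw [comp_ofSeq, comp_ofSeq]
  by_cases h : k = n <;> simp [h, comp, fibreInner, projSeq]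

/-- The projection `Q_n` of the Fock module onto its `n`-th fibre. -/
noncomputable def proj (n : ℕ) : Adjointable (Ω → ℂ) (Fock P) :=
  ⟨ofSeq (projSeq n) (isBounded_projSeq n), ofSeq (projSeq n) (isBounded_projSeq n),
    inner_projSeq n⟩

theorem comp_proj (n : ℕ) (x : Fock P) (k : ℕ) :
    ((proj n).1 x).comp k = if k = n then x.comp k else 0 := by
  rw [proj, comp_ofSeq]
  by_cases h : k = n <;> simp [h, comp, projSeq]

theorem isBounded_diagonal (a : Ω → ℂ) (T : (∀ n, Arv P n) →ₗ[ℂ] (∀ n, Arv P n))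
    (hT : ∀ x n, (T x n).1 = diagonal a * (x n).1) : IsBounded T := by
  refine ⟨Set.univ, id, ‖a‖ ^ 2, Function.injective_id.injOn, by positivity, by simp,
    fun x k _ j => ?_⟩
  rw [hT]
  simp only [colSq, diagonal_mul, norm_mul, mul_pow, Finset.mul_sum, id]
  gcongr with i
  exact norm_le_pi_norm a i

/-- Left multiplication by a diagonal matrix in every fibre, on sequences. -/
noncomputable def leftSeq (a : Ω → ℂ) : (∀ n, Arv P n) →ₗ[ℂ] (∀ n, Arv P n) where
  toFun x n := ⟨diagonal a * (x n).1, fun i j h => by simp [(x n).2 i j h]⟩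
  map_add' x y := by ext n : 2; simp [mul_add]
  map_smul' z x := by ext n : 2; simp

/-- The left action of `a ∈ ℓ^∞(Ω)` on the Fock module: left multiplication by the diagonal matrix
of `a` in every fibre. -/
noncomputable def leftAction (a : Ω → ℂ) : Adjointable (Ω → ℂ) (Fock P) :=
  ⟨ofSeq (leftSeq a) (isBounded_diagonal a _ fun _ _ => rfl),
    ofSeq (leftSeq (star a)) (isBounded_diagonal _ _ fun _ _ => rfl), fun x y => by
      rw [inner_def, inner_def]
      refine tsum_congr fun k => funext fun j => ?_
      rw [comp_ofSeq, comp_ofSeq, fibreInner_apply, fibreInner_apply]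
      refine Finset.sum_congr rfl fun i _ => ?_
      simp only [leftSeq, LinearMap.coe_mk, AddHom.coe_mk, diagonal_mul, star_mul', Pi.star_apply,
        comp]
      ring⟩

theorem comp_leftAction (a : Ω → ℂ) (x : Fock P) (n : ℕ) :
    ((leftAction a).1 x).comp n = diagonal a * x.comp n := rfl

/-! #### The shifts -/

/-- The coefficients of the subproduct maps. -/
noncomputable def coeff (P : rowStochastic ℝ Ω) (n m : ℕ) (i l j : Ω) : ℝ :=
  flat (entrySqrt ((P : Matrix Ω Ω ℝ) ^ (n + m))) i j *
    (entrySqrt ((P : Matrix Ω Ω ℝ) ^ n) i l * entrySqrt ((P : Matrix Ω Ω ℝ) ^ m) l j)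

theorem pow_nonneg_apply (P : rowStochastic ℝ Ω) (n : ℕ) (i j : Ω) :
    0 ≤ ((P : Matrix Ω Ω ℝ) ^ n) i j := (pow_mem P.2 n).1 i j

theorem coeff_def (n m : ℕ) (i l j : Ω) : coeff P n m i l j =
    (if 0 < √(((P : Matrix Ω Ω ℝ) ^ (n + m)) i j) then (√(((P : Matrix Ω Ω ℝ) ^ (n + m)) i j))⁻¹
      else 0) * (√(((P : Matrix Ω Ω ℝ) ^ n) i l) * √(((P : Matrix Ω Ω ℝ) ^ m) l j)) := rfl

theorem coeff_nonneg (n m : ℕ) (i l j : Ω) : 0 ≤ coeff P n m i l j := by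
  rw [coeff_def]
  split_ifs <;> positivity

theorem coeff_le_one (n m : ℕ) (i l j : Ω) : coeff P n m i l j ≤ 1 := by
  rw [coeff_def]
  split_ifs with h
  · rw [inv_mul_le_one₀ h, ← Real.sqrt_mul (pow_nonneg_apply P n i l)]
    refine Real.sqrt_le_sqrt ?_
    rw [pow_add, Matrix.mul_apply]
    exact Finset.single_le_sum (f := fun l => ((P : Matrix Ω Ω ℝ) ^ n) i l *
      ((P : Matrix Ω Ω ℝ) ^ m) l j) (fun l _ => mul_nonneg (pow_nonneg_apply P n i l)
        (pow_nonneg_apply P m l j)) (Finset.mem_univ l)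
  · rw [zero_mul]
    exact zero_le_one

theorem coeff_eq_zero {n m : ℕ} {i l j : Ω} (h : ¬ 0 < ((P : Matrix Ω Ω ℝ) ^ m) l j) :
    coeff P n m i l j = 0 := by
  simp [coeff, entrySqrt, Real.sqrt_eq_zero_of_nonpos (not_lt.1 h)]

theorem subproductMul_apply (n m : ℕ) (A B : Matrix Ω Ω ℂ) (i j : Ω) :
    subproductMul P n m A B i j = ∑ l, (coeff P n m i l j : ℂ) * A i l * B l j := by
  simp only [subproductMul, toComplex, hadamard_apply, Matrix.mul_apply, of_apply, coeff,
    Finset.mul_sum]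
  push_cast
  exact Finset.sum_congr rfl fun l _ => by ring

/-- The adjoint of `B ↦ U_{n,m}(A ⊗ B)` between the fibres of degree `m` and `n + m`. -/
noncomputable def subproductAdj (P : rowStochastic ℝ Ω) (n m : ℕ) (A B : Matrix Ω Ω ℂ) :
    Matrix Ω Ω ℂ :=
  of fun l j => ∑ i, (coeff P n m i l j : ℂ) * star (A i l) * B i j

theorem subproductAdj_mem (n m : ℕ) (A B : Matrix Ω Ω ℂ) : subproductAdj P n m A B ∈ Arv P m := by
  intro l j h
  simp [subproductAdj, coeff_eq_zero h]

theorem fibreInner_subproductMul (n m : ℕ) (A B C : Matrix Ω Ω ℂ) :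
    fibreInner (subproductMul P n m A B) C = fibreInner B (subproductAdj P n m A C) := by
  ext j
  simp only [fibreInner_apply, subproductMul_apply, subproductAdj, of_apply, star_sum,
    Finset.sum_mul, Finset.mul_sum, star_mul']
  rw [Finset.sum_comm]
  refine Finset.sum_congr rfl fun l _ => Finset.sum_congr rfl fun i _ => ?_
  simp only [Complex.star_def, Complex.conj_ofReal]
  ring

theorem norm_sum_sq_le {c : Ω → ℝ} (h0 : ∀ i, 0 ≤ c i) (h1 : ∀ i, c i ≤ 1) (a b : Ω → ℂ) :
    ‖∑ i, (c i : ℂ) * a i * b i‖ ^ 2 ≤ (∑ i, ‖a i‖ ^ 2) * ∑ i, ‖b i‖ ^ 2 := by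
  refine le_trans ?_ (Finset.sum_mul_sq_le_sq_mul_sq _ (fun i => ‖a i‖) fun i => ‖b i‖)
  gcongr
  refine (norm_sum_le _ _).trans (Finset.sum_le_sum fun i _ => ?_)
  rw [norm_mul, norm_mul, Complex.norm_real, Real.norm_of_nonneg (h0 i)]
  gcongr
  exact mul_le_of_le_one_left (norm_nonneg _) (h1 i)

theorem colSq_subproductMul_le (n m : ℕ) (A B : Matrix Ω Ω ℂ) (j : Ω) :
    colSq (subproductMul P n m A B) j ≤ (∑ i, ∑ l, ‖A i l‖ ^ 2) * colSq B j := by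
  rw [colSq, colSq, Finset.sum_mul]
  refine Finset.sum_le_sum fun i _ => ?_
  rw [subproductMul_apply]
  exact norm_sum_sq_le (fun l => coeff_nonneg n m i l j) (fun l => coeff_le_one n m i l j)
    (fun l => A i l) fun l => B l j

theorem colSq_subproductAdj_le (n m : ℕ) (A B : Matrix Ω Ω ℂ) (j : Ω) :
    colSq (subproductAdj P n m A B) j ≤ (∑ i, ∑ l, ‖A i l‖ ^ 2) * colSq B j := by
  rw [colSq, colSq, Finset.sum_comm, Finset.sum_mul]
  refine Finset.sum_le_sum fun l _ => ?_
  have := norm_sum_sq_le (fun i => coeff_nonneg (P := P) n m i l j)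
    (fun i => coeff_le_one n m i l j) (fun i => star (A i l)) fun i => B i j
  simp only [norm_star] at this
  exact this

/-- The shift by `A` on sequences: `x m` of degree `m` is sent to `U_{n,m}(A ⊗ x m)` of degree
`n + m`. -/
noncomputable def shiftSeq (n : ℕ) (A : Arv P n) : (∀ n, Arv P n) →ₗ[ℂ] (∀ n, Arv P n) where
  toFun x k := if h : n ≤ k then ⟨subproductMul P n (k - n) A.1 (x (k - n)).1, by
    have := subproductMul_mem P n (k - n) A.1 (x (k - n)).1
    rwa [Nat.add_sub_cancel' h] at this⟩ else 0
  map_add' x y := by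
    ext k i j
    by_cases h : n ≤ k
    · simp [h, subproductMul_apply, mul_add, Finset.sum_add_distrib]
    · simp [h]
  map_smul' z x := by
    ext k i j
    by_cases h : n ≤ k
    · simp [h, subproductMul_apply, Finset.mul_sum, mul_left_comm]
    · simp [h]

/-- The adjoint of the shift by `A` on sequences. -/
noncomputable def shiftAdjSeq (n : ℕ) (A : Arv P n) : (∀ n, Arv P n) →ₗ[ℂ] (∀ n, Arv P n) where
  toFun x m := ⟨subproductAdj P n m A.1 (x (n + m)).1, subproductAdj_mem _ _ _ _⟩
  map_add' x y := by
    ext k i j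
    simp [subproductAdj, mul_add, Finset.sum_add_distrib]
  map_smul' z x := by
    ext k i j
    simp [subproductAdj, Finset.mul_sum, mul_left_comm]

theorem isBounded_shiftSeq (n : ℕ) (A : Arv P n) : IsBounded (shiftSeq n A) := by
  refine ⟨{k | n ≤ k}, fun k => k - n, ∑ i, ∑ l, ‖A.1 i l‖ ^ 2, fun a ha b hb h => ?_,
    by positivity, fun x k hk => ?_, fun x k hk j => ?_⟩
  · have ha : n ≤ a := ha
    have hb : n ≤ b := hb
    have h : a - n = b - n := h
    omega
  · have hk : ¬ n ≤ k := hk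
    simp [shiftSeq, hk]
  · have hk : n ≤ k := hk
    simp only [shiftSeq, LinearMap.coe_mk, AddHom.coe_mk, hk, dif_pos]
    exact colSq_subproductMul_le _ _ _ _ _

theorem isBounded_shiftAdjSeq (n : ℕ) (A : Arv P n) : IsBounded (shiftAdjSeq n A) :=
  ⟨Set.univ, fun k => n + k, ∑ i, ∑ l, ‖A.1 i l‖ ^ 2, (add_right_injective n).injOn,
    by positivity, by simp, fun _ _ _ j => colSq_subproductAdj_le _ _ _ _ j⟩

/-- The shift `S_A^{(n)}` for `A ∈ Arv(P)_n`: the adjointable operator on the Fock module with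
`S_A^{(n)}(B) = U_{n,m}(A ⊗ B)` for `B ∈ Arv(P)_m`. -/
noncomputable def shift (n : ℕ) (A : Arv P n) : Adjointable (Ω → ℂ) (Fock P) :=
  ⟨ofSeq (shiftSeq n A) (isBounded_shiftSeq n A),
    ofSeq (shiftAdjSeq n A) (isBounded_shiftAdjSeq n A), fun x y => by
      rw [inner_def, inner_def, ← (summable_fibreInner _ _).sum_add_tsum_nat_add n,
        Finset.sum_eq_zero, zero_add]
      · refine tsum_congr fun k => ?_
        rw [comp_ofSeq, comp_ofSeq]
        have h : n ≤ k + n := Nat.le_add_left n k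
        simp only [shiftSeq, shiftAdjSeq, LinearMap.coe_mk, AddHom.coe_mk, h, dif_pos]
        rw [fibreInner_subproductMul, Nat.add_sub_cancel, add_comm k n]
        rfl
      · intro k hk
        have h : ¬ n ≤ k := not_le.2 (Finset.mem_range.1 hk)
        rw [comp_ofSeq]
        simp [shiftSeq, h, fibreInner]⟩

theorem comp_shift_add (n : ℕ) (A : Arv P n) (x : Fock P) (m : ℕ) :
    ((shift n A).1 x).comp (n + m) = subproductMul P n m A.1 (x.comp m) := by
  rw [shift, comp_ofSeq]
  have h : n ≤ n + m := Nat.le_add_right n m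
  simp only [shiftSeq, LinearMap.coe_mk, AddHom.coe_mk, h, dif_pos]
  rw [Nat.add_sub_cancel_left]
  rfl

theorem comp_shift_of_lt (n : ℕ) (A : Arv P n) (x : Fock P) {k : ℕ} (h : k < n) :
    ((shift n A).1 x).comp k = 0 := by
  rw [shift, comp_ofSeq]
  simp [shiftSeq, not_le.2 h]

end Fock
end Fock

/-! ### The Toeplitz algebra and the Cuntz–Pimsner algebra -/

open Fock

section Algebras

variable (P : rowStochastic ℝ Ω)

/-- The generators of the Toeplitz algebra: the left action of `ℓ^∞(Ω)` and all shifts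
`S_A^{(n)}`, `n ∈ ℕ`, `A ∈ Arv(P)_n`. -/
def toeplitzGenerators : Set (Adjointable (Ω → ℂ) (Fock P)) :=
  {S | ∃ a : Ω → ℂ, S = leftAction a} ∪ {S | ∃ (n : ℕ) (A : Arv P n), S = shift n A}

/-- The Toeplitz algebra `𝓣(P)`: the C⋆-subalgebra of `𝓛(⨁ n, Arv(P)_n)` generated by
`ℓ^∞(Ω)` and the shifts. (It is unital, since `1 ∈ ℓ^∞(Ω)` acts as the identity.) -/
noncomputable def Toeplitz : StarSubalgebra ℂ (Adjointable (Ω → ℂ) (Fock P)) :=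
  (StarAlgebra.adjoin ℂ (toeplitzGenerators P)).topologicalClosure

theorem star_proj (n : ℕ) : star (proj n : Adjointable (Ω → ℂ) (Fock P)) = proj n :=
  Subtype.ext <| Adjointable.star_eq fun x y => inner_projSeq n x y

theorem proj_mul_proj (n : ℕ) : (proj n * proj n : Adjointable (Ω → ℂ) (Fock P)) = proj n := by
  refine Adjointable.ext fun x => Fock.ext fun k => ?_
  change ((proj n).1 ((proj n).1 x)).comp k = ((proj n).1 x).comp k
  simp only [comp_proj]
  split_ifs <;> rfl

theorem norm_proj_le (n : ℕ) : ‖(proj n : Adjointable (Ω → ℂ) (Fock P))‖ ≤ 1 := by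
  have h := CStarRing.norm_star_mul_self (x := (proj n : Adjointable (Ω → ℂ) (Fock P)))
  rw [star_proj, proj_mul_proj] at h
  nlinarith [norm_nonneg (proj n : Adjointable (Ω → ℂ) (Fock P))]

/-- The set `𝓙` of the operators `T ∈ 𝓛(⨁ n, Arv(P)_n)` with `‖T Q_n‖ → 0`. -/
def vanishing : Set (Adjointable (Ω → ℂ) (Fock P)) :=
  {T | Tendsto (fun n => ‖T * proj n‖) atTop (𝓝 0)}

variable {P}

theorem mem_vanishing_iff {T : Adjointable (Ω → ℂ) (Fock P)} :
    T ∈ vanishing P ↔ Tendsto (fun n => T * proj n) atTop (𝓝 0) :=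
  tendsto_zero_iff_norm_tendsto_zero.symm

theorem add_mem_vanishing {S T : Adjointable (Ω → ℂ) (Fock P)} (hS : S ∈ vanishing P)
    (hT : T ∈ vanishing P) : S + T ∈ vanishing P := by
  rw [mem_vanishing_iff] at *
  simpa only [add_mul, add_zero] using hS.add hT

theorem mul_mem_vanishing (S : Adjointable (Ω → ℂ) (Fock P)) {T : Adjointable (Ω → ℂ) (Fock P)}
    (hT : T ∈ vanishing P) : S * T ∈ vanishing P := by
  rw [mem_vanishing_iff] at *
  simpa only [mul_assoc, mul_zero] using hT.const_mul S

theorem isClosed_vanishing : IsClosed (vanishing P) := by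
  refine isClosed_of_closure_subset fun T hT => ?_
  refine Metric.tendsto_atTop.2 fun ε hε => ?_
  obtain ⟨S, hS, hTS⟩ := Metric.mem_closure_iff.1 hT (ε / 2) (half_pos hε)
  obtain ⟨N, hN⟩ := Metric.tendsto_atTop.1 hS (ε / 2) (half_pos hε)
  refine ⟨N, fun n hn => ?_⟩
  have h1 := hN n hn
  rw [dist_eq_norm] at hTS
  rw [Real.dist_eq, sub_zero, abs_norm] at h1 ⊢
  have h2 : T * proj n = (T - S) * proj n + S * proj n := by rw [sub_mul, sub_add_cancel]
  rw [h2]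
  have h3 : ‖(T - S) * proj n‖ ≤ ‖T - S‖ :=
    (norm_mul_le _ _).trans (mul_le_of_le_one_right (norm_nonneg _) (norm_proj_le P n))
  linarith [norm_add_le ((T - S) * proj n) (S * proj n)]

/-- `𝓙` is stable under right multiplication by operators of a fixed degree. -/
theorem mul_mem_vanishing_of_comm {R : Adjointable (Ω → ℂ) (Fock P)} {σ : ℕ → ℕ}
    (hσ : Tendsto σ atTop atTop) (hR : ∀ᶠ m in atTop, R * proj m = proj (σ m) * R)
    {T : Adjointable (Ω → ℂ) (Fock P)} (hT : T ∈ vanishing P) : T * R ∈ vanishing P := by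
  rw [mem_vanishing_iff] at *
  have h := (hT.comp hσ).mul_const R
  rw [zero_mul] at h
  refine h.congr' (hR.mono fun m hm => ?_)
  simp only [Function.comp_apply]
  rw [mul_assoc, ← hm, mul_assoc]

theorem leftAction_mul_proj (a : Ω → ℂ) (m : ℕ) :
    (leftAction a * proj m : Adjointable (Ω → ℂ) (Fock P)) = proj m * leftAction a := by
  refine Adjointable.ext fun x => Fock.ext fun k => ?_
  change ((leftAction a).1 ((proj m).1 x)).comp k = ((proj m).1 ((leftAction a).1 x)).comp k
  simp only [comp_proj, comp_leftAction]
  split_ifs <;> simp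

theorem shift_mul_proj (n : ℕ) (A : Arv P n) (m : ℕ) :
    shift n A * proj m = proj (n + m) * shift n A := by
  refine Adjointable.ext fun x => Fock.ext fun k => ?_
  change ((shift n A).1 ((proj m).1 x)).comp k = ((proj (n + m)).1 ((shift n A).1 x)).comp k
  rw [comp_proj]
  rcases lt_or_ge k n with h | h
  · simp [comp_shift_of_lt n A _ h]
  · obtain ⟨l, rfl⟩ := Nat.exists_eq_add_of_le h
    rw [comp_shift_add, comp_shift_add, comp_proj]
    by_cases hl : l = m
    · simp [hl]
    · simp [hl, subproductMul]

theorem mul_generator_mem_vanishing {T R : Adjointable (Ω → ℂ) (Fock P)} (hT : T ∈ vanishing P)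
    (hR : R ∈ toeplitzGenerators P) : T * R ∈ vanishing P := by
  rcases hR with ⟨a, rfl⟩ | ⟨n, A, rfl⟩
  · exact mul_mem_vanishing_of_comm tendsto_id (.of_forall fun m => leftAction_mul_proj a m) hT
  · exact mul_mem_vanishing_of_comm (tendsto_atTop_mono (fun m => Nat.le_add_left m n) tendsto_id)
      (.of_forall fun m => shift_mul_proj n A m) hT

theorem mul_star_generator_mem_vanishing {T R : Adjointable (Ω → ℂ) (Fock P)}
    (hT : T ∈ vanishing P) (hR : R ∈ toeplitzGenerators P) : T * star R ∈ vanishing P := by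
  rcases hR with ⟨a, rfl⟩ | ⟨n, A, rfl⟩
  · refine mul_mem_vanishing_of_comm tendsto_id (.of_forall fun m => ?_) hT
    have := congrArg star (leftAction_mul_proj (P := P) a m)
    rw [star_mul, star_mul, star_proj] at this
    exact this.symm
  · refine mul_mem_vanishing_of_comm (tendsto_sub_atTop_nat n) ?_ hT
    filter_upwards [eventually_ge_atTop n] with m hm
    have := congrArg star (shift_mul_proj n A (m - n))
    rw [star_mul, star_mul, star_proj, star_proj, Nat.add_sub_cancel' hm] at this
    exact this.symm

theorem mul_adjoin_mem_vanishing {R : Adjointable (Ω → ℂ) (Fock P)}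
    (hR : R ∈ Algebra.adjoin ℂ (toeplitzGenerators P ∪ star (toeplitzGenerators P))) :
    ∀ T ∈ vanishing P, T * R ∈ vanishing P := by
  refine Algebra.adjoin_induction (p := fun R _ => ∀ T ∈ vanishing P, T * R ∈ vanishing P)
    ?_ ?_ ?_ ?_ hR
  · rintro R (hR | hR) T hT
    · exact mul_generator_mem_vanishing hT hR
    · rw [← star_star R]
      exact mul_star_generator_mem_vanishing hT hR
  · intro z T hT
    rw [← Algebra.commutes]
    exact mul_mem_vanishing _ hT
  · intro R S _ _ h1 h2 T hT
    rw [mul_add]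
    exact add_mem_vanishing (h1 T hT) (h2 T hT)
  · intro R S _ _ h1 h2 T hT
    rw [← mul_assoc]
    exact h2 _ (h1 T hT)

theorem mul_toeplitz_mem_vanishing {T R : Adjointable (Ω → ℂ) (Fock P)} (hT : T ∈ vanishing P)
    (hR : R ∈ Toeplitz P) : T * R ∈ vanishing P := by
  have hcl : IsClosed ((fun R => T * R) ⁻¹' vanishing P) :=
    isClosed_vanishing.preimage (continuous_const_mul T)
  have hsub : (StarAlgebra.adjoin ℂ (toeplitzGenerators P) : Set (Adjointable (Ω → ℂ) (Fock P))) ⊆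
      (fun R => T * R) ⁻¹' vanishing P := fun R hR => mul_adjoin_mem_vanishing hR T hT
  have hmem : R ∈ (fun R => T * R) ⁻¹' vanishing P := closure_minimal hsub hcl hR
  exact hmem

variable (P)

/-- The Cuntz–Pimsner ideal `𝓙(𝓣(P)) = 𝓙 ∩ 𝓣(P)` of the Toeplitz algebra. -/
def cuntzPimsnerIdeal : Ideal (Toeplitz P) where
  carrier := {T | (T : Adjointable (Ω → ℂ) (Fock P)) ∈ vanishing P}
  add_mem' hS hT := add_mem_vanishing hS hT
  zero_mem' := mem_vanishing_iff.2 <| by simp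
  smul_mem' S _ hT := mul_mem_vanishing S.1 hT

instance : (cuntzPimsnerIdeal P).IsTwoSided :=
  ⟨fun R hT => mul_toeplitz_mem_vanishing hT R.2⟩

theorem star_mem_cuntzPimsnerIdeal {T : Toeplitz P} (hT : T ∈ cuntzPimsnerIdeal P) :
    star T ∈ cuntzPimsnerIdeal P := by
  have : IsClosed (Toeplitz P : Set (Adjointable (Ω → ℂ) (Fock P))) :=
    StarSubalgebra.isClosed_topologicalClosure _
  let _ : CStarAlgebra (Toeplitz P) := StarSubalgebra.cstarAlgebra (Toeplitz P)
  exact Ideal.star_mem_of_isClosed (cuntzPimsnerIdeal P)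
    (isClosed_vanishing.preimage continuous_subtype_val) hT

/-- The Cuntz–Pimsner algebra `𝓞(P) = 𝓣(P) / 𝓙(𝓣(P))`. -/
abbrev CuntzPimsner : Type _ := Toeplitz P ⧸ cuntzPimsnerIdeal P

/-- The involution of `𝓞(P)`, induced by the involution of `𝓣(P)`. -/
noncomputable instance : StarRing (CuntzPimsner P) where
  star := Quotient.map' star fun S T h => by
    rw [Submodule.quotientRel_def] at h ⊢
    exact star_sub S T ▸ star_mem_cuntzPimsnerIdeal P h
  star_involutive x := by
    obtain ⟨x, rfl⟩ := Ideal.Quotient.mk_surjective x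
    exact congrArg (Ideal.Quotient.mk (cuntzPimsnerIdeal P)) (star_star x)
  star_mul x y := by
    obtain ⟨x, rfl⟩ := Ideal.Quotient.mk_surjective x
    obtain ⟨y, rfl⟩ := Ideal.Quotient.mk_surjective y
    exact congrArg (Ideal.Quotient.mk (cuntzPimsnerIdeal P)) (star_mul x y)
  star_add x y := by
    obtain ⟨x, rfl⟩ := Ideal.Quotient.mk_surjective x
    obtain ⟨y, rfl⟩ := Ideal.Quotient.mk_surjective y
    exact congrArg (Ideal.Quotient.mk (cuntzPimsnerIdeal P)) (star_add x y)

theorem star_mk (T : Toeplitz P) : star (Ideal.Quotient.mk (cuntzPimsnerIdeal P) T) =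
    Ideal.Quotient.mk (cuntzPimsnerIdeal P) (star T) := rfl

end Algebras
end StochasticMatrix

/-! Irreducibility provides a period `r` and a phase for every state such that, for large `n`, `(P ^
n) i j > 0` exactly when `r` divides `n + phase j - phase i`. In a fixed column `j` of the Fock
module, label the matrix unit `(i, j)` of degree `n` by the quotient `t = (n + phase j - phase i) /
r` and regard it as the Fourier monomial of frequency `t` in the coordinate `i`. In high degrees the
column then looks like the part of `L²(𝕋)^Ω` with large frequencies.

The shift by `A` of degree `n` maps the unit `(l, j)` of degree `k` to units `(i, j)` of degree `n +
k`, with coefficients `√((P ^ n) i l * (P ^ k) l j / (P ^ (n + k)) i j) * A i l`. Multiplication by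
a stochastic matrix averages the entries of a column, so the oscillation of the positive entries of
column `j` contracts, while they stay bounded away from `0`. Hence the coefficients tend to `√((P ^
n) i l) * A i l` (`tendsto_coeff`). Asymptotically the shift is multiplication by the matrix of
functions with entries `√((P ^ n) i l) * A i l * z ^ ((n + phase l - phase i) / r)`, which does not
depend on the column.

This defines a symbol (`HasSymbol`), tested on function vectors whose frequencies are moved to
infinity. The symbol is unique and its entries are bounded by the operator norm, it is
multiplicative, and it survives norm limits. Convergence on vectors does not pass to adjoints, so
`symbolic` asks for the symbol of the adjoint separately. The result is a ⋆-homomorphism from the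
Toeplitz algebra to the matrices over `C(𝕋)`.

Its kernel is the Cuntz–Pimsner ideal (`HasSymbol.mem_vanishing_iff`), because each fibre is spanned
by a bounded number of matrix units. Its range is closed and contains every matrix unit times every
Fourier monomial, so it is everything (`symbolHom_surjective`). The period leaves no trace in the
quotient since the phases absorb it: every large frequency occurs in every entry. -/

/-! ### Closed range of ⋆-homomorphisms -/

/-- An element of the range of a ⋆-homomorphism of C⋆-algebras has a preimage of no larger norm. -/
theorem StarAlgHom.exists_preimage_norm_le {A B : Type*} [CStarAlgebra A] [CStarAlgebra B]
    (φ : A →⋆ₐ[ℂ] B) (x : A) : ∃ y, φ y = φ x ∧ ‖y‖ ≤ ‖φ x‖ := by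
  let _ := CStarAlgebra.spectralOrder A
  have := CStarAlgebra.spectralOrderedRing A
  let _ := CStarAlgebra.spectralOrder B
  have := CStarAlgebra.spectralOrderedRing B
  rcases (norm_nonneg (φ x)).eq_or_lt with h0 | h0
  · exact ⟨0, by rw [map_zero, norm_eq_zero.1 h0.symm], by simp⟩
  have : Nontrivial B := ⟨φ x, 0, norm_pos_iff.1 h0⟩
  set s := ‖φ x‖ ^ 2 with hs
  have hs0 : 0 < s := by positivity
  set h := star x * x with hh
  have hsa : IsSelfAdjoint h := .star_mul_self x
  have hsp : ∀ t ∈ spectrum ℝ h, 0 ≤ t := fun t ht =>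
    spectrum_nonneg_of_nonneg (star_mul_self_nonneg x) ht
  -- The cutoff `g` equals `1` on `[0, s]`, which contains the spectrum of `φ h`, so `φ (x * g h) =
  -- φ x`. It also satisfies `g t ^ 2 * t ≤ s` for `t ≥ 0`, which bounds the norm of `x * g h`.
  let g : ℝ → ℝ := fun t => √(s / max s t)
  have hm : ∀ t, 0 < max s t := fun t => lt_max_of_lt_left hs0
  have hg : Continuous g :=
    (continuous_const.div (continuous_const.max continuous_id) fun t => (hm t).ne').sqrt
  refine ⟨x * cfc g h, ?_, ?_⟩
  · have e : φ (cfc g h) = 1 := by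
      have hφc : Continuous φ := map_continuous φ
      rw [StarAlgHomClass.map_cfc φ g h hg.continuousOn hφc hsa (hsa.map φ),
        ← cfc_const_one ℝ (φ h) (hsa.map φ)]
      refine cfc_congr fun t ht => ?_
      have ht1 : ‖t‖ ≤ ‖φ h‖ := spectrum.norm_le_norm_of_mem ht
      rw [hh, map_mul, map_star, CStarRing.norm_star_mul_self, ← pow_two, ← hs] at ht1
      simp only [g]
      rw [max_eq_left ((Real.le_norm_self t).trans ht1), div_self hs0.ne', Real.sqrt_one]
    rw [map_mul, e, mul_one]
  · have hgs : IsSelfAdjoint (cfc g h) := cfc_predicate _ _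
    have e : star (x * cfc g h) * (x * cfc g h) = cfc (fun t => g t * (t * g t)) h := by
      rw [cfc_mul g (fun t => t * g t) h hg.continuousOn (by fun_prop),
        cfc_mul (fun t => t) g h (by fun_prop) hg.continuousOn, cfc_id' ℝ h, star_mul, hgs.star_eq,
        hh]
      noncomm_ring
    refine le_of_sq_le_sq ?_ h0.le
    rw [pow_two ‖x * _‖, ← CStarRing.norm_star_mul_self, e]
    refine norm_cfc_le hs0.le fun t ht => ?_
    have ht0 := hsp t ht
    have : g t * (t * g t) = s * (t / max s t) := by
      rw [mul_left_comm, Real.mul_self_sqrt (by have := hm t; positivity)]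
      ring
    rw [this, Real.norm_of_nonneg (by have := hm t; positivity)]
    exact mul_le_of_le_one_right hs0.le ((div_le_one (hm t)).2 (le_max_right _ _))

/-- The range of a ⋆-homomorphism of C⋆-algebras is closed. -/
theorem StarAlgHom.isClosed_range {A B : Type*} [CStarAlgebra A] [CStarAlgebra B]
    (φ : A →⋆ₐ[ℂ] B) : IsClosed (Set.range φ) := by
  let F : NormedAddGroupHom A B := φ.toAlgHom.toLinearMap.toAddMonoidHom.mkNormedAddGroupHom 1
    fun x => by simpa using NonUnitalStarAlgHom.norm_apply_le φ x
  have hF : F.SurjectiveOnWith F.range 1 := by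
    rintro _ ⟨x, rfl⟩
    obtain ⟨y, hy, hle⟩ := StarAlgHom.exists_preimage_norm_le φ x
    exact ⟨y, hy, by rw [one_mul]; exact hle⟩
  -- Preimages of controlled norm allow a point of the closure to be written as a convergent series
  -- of images; completeness of `A` sums the preimages.
  have hc := controlled_closure_of_complete one_pos one_pos hF
  refine isClosed_of_closure_subset fun y hy => ?_
  obtain ⟨x, hx, -⟩ := hc y hy
  exact ⟨x, hx⟩

/-! ### Period and phases -/

namespace StochasticMatrix

open CStarModule Matrix Fock

variable {Ω : Type*} [Fintype Ω] [DecidableEq Ω] {P : rowStochastic ℝ Ω}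

theorem pow_pos_trans {n m : ℕ} {i l j : Ω} (h₁ : 0 < ((P : Matrix Ω Ω ℝ) ^ n) i l)
    (h₂ : 0 < ((P : Matrix Ω Ω ℝ) ^ m) l j) : 0 < ((P : Matrix Ω Ω ℝ) ^ (n + m)) i j := by
  rw [pow_add, Matrix.mul_apply]
  exact Finset.sum_pos' (fun l _ => mul_nonneg (pow_nonneg_apply P n i l) (pow_nonneg_apply P m l j))
    ⟨l, Finset.mem_univ l, mul_pos h₁ h₂⟩

theorem sum_pow_apply (P : rowStochastic ℝ Ω) (n : ℕ) (i : Ω) :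
    ∑ l, ((P : Matrix Ω Ω ℝ) ^ n) i l = 1 :=
  sum_row_of_mem_rowStochastic (pow_mem P.2 n) i

variable (P) in
/-- The cyclic decomposition of an irreducible stochastic matrix: a period, and a phase of every
state which determines the supports of all high powers. -/
structure CyclicStructure where
  /-- The period. -/
  period : ℕ
  /-- The phase of a state; it drops by one, modulo the period, along every edge. -/
  phase : Ω → ℤ
  /-- From this power on the support is determined by the phases. -/
  bound : ℕ
  period_pos : 0 < period
  dvd_of_pos : ∀ {n : ℕ} {i j : Ω}, 0 < ((P : Matrix Ω Ω ℝ) ^ n) i j →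
    (period : ℤ) ∣ n + phase j - phase i
  pos_of_dvd : ∀ {n : ℕ} {i j : Ω}, bound ≤ n → (period : ℤ) ∣ n + phase j - phase i →
    0 < ((P : Matrix Ω Ω ℝ) ^ n) i j

/-- An irreducible stochastic matrix has a cyclic decomposition. -/
theorem nonempty_cyclicStructure (hP : (P : Matrix Ω Ω ℝ).IsIrreducible) :
    Nonempty (CyclicStructure P) := by
  rcases isEmpty_or_nonempty Ω with hΩ | ⟨⟨o⟩⟩
  · exact ⟨⟨1, 0, 0, one_pos, fun {_ i} => hΩ.elim i, fun {_ i} => hΩ.elim i⟩⟩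
  have hpath := (isIrreducible_iff_exists_pow_pos hP.nonneg).1 hP
  choose a ha0 ha using fun i => hpath o i
  choose b hb0 hb using fun i => hpath i o
  -- The return times of the base point `o`. They form a numerical semigroup, which contains all
  -- large multiples of its gcd, the period.
  let S : AddSubmonoid ℕ :=
    { carrier := {n | 0 < ((P : Matrix Ω Ω ℝ) ^ n) o o}
      add_mem' := fun h₁ h₂ => pow_pos_trans h₁ h₂
      zero_mem' := by simp }
  set r := Nat.setGcd (S : Set ℕ) with hr
  have hdvd : ∀ n : ℕ, 0 < ((P : Matrix Ω Ω ℝ) ^ n) o o → (r : ℤ) ∣ n := fun n hn =>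
    Int.natCast_dvd_natCast.2 (Nat.setGcd_dvd_of_mem (s := (S : Set ℕ)) hn)
  obtain ⟨N, hN⟩ := Nat.exists_mem_closure_of_ge (S : Set ℕ)
  rw [AddSubmonoid.closure_eq] at hN
  have hab : ∀ i, (r : ℤ) ∣ a i + b i := fun i => by
    exact_mod_cast hdvd _ (pow_pos_trans (ha i) (hb i))
  -- The phase of `i` is the length of a chosen path from `i` to `o`; modulo `r` it does not depend
  -- on the path.
  refine ⟨⟨r, fun i => b i, N + ∑ i, a i + ∑ i, b i, ?_, fun {n i j} h => ?_,
    fun {n i j} hn h => ?_⟩⟩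
  · refine Nat.pos_of_ne_zero fun h0 => ?_
    have := Nat.setGcd_eq_zero_iff.1 h0 (show a o ∈ (S : Set ℕ) from ha o)
    exact (ha0 o).ne' this
  · have h1 := hdvd _ (pow_pos_trans (pow_pos_trans (ha i) h) (hb j))
    obtain ⟨x, hx⟩ := h1
    obtain ⟨y, hy⟩ := hab i
    push_cast at hx
    exact ⟨x - y, by linear_combination hx - hy⟩
  · have hj := Finset.single_le_sum (f := a) (fun _ _ => Nat.zero_le _) (Finset.mem_univ j)
    have hi := Finset.single_le_sum (f := b) (fun _ _ => Nat.zero_le _) (Finset.mem_univ i)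
    -- Route the path as `i → o → o → j`; the bound leaves at least `N` steps for the loop at `o`.
    obtain ⟨k, rfl⟩ : ∃ k, n = b i + k + a j := ⟨n - b i - a j, by omega⟩
    refine pow_pos_trans (pow_pos_trans (hb i) (hN k (by omega) ?_)) (ha j)
    rw [← Int.natCast_dvd_natCast]
    obtain ⟨x, hx⟩ := h
    obtain ⟨y, hy⟩ := hab j
    push_cast at hx
    exact ⟨x - y, by linear_combination hx - hy⟩

/-! ### Contraction of the columns of the powers -/

/-- The positive values of a function on a finite type are bounded away from `0`. -/
theorem exists_pos_le_of_pos {ι : Type*} [Finite ι] (f : ι → ℝ) :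
    ∃ δ > 0, ∀ i, 0 < f i → δ ≤ f i := by
  rcases isEmpty_or_nonempty ι with h | h
  · exact ⟨1, one_pos, fun i => h.elim i⟩
  obtain ⟨i₀, hi₀⟩ := Finite.exists_min fun i => if 0 < f i then f i else 1
  refine ⟨if 0 < f i₀ then f i₀ else 1, by split_ifs <;> simp_all, fun i hi => ?_⟩
  simpa [hi] using hi₀ i

/-- After subtracting `α` (or subtracting from `β`) all terms of positive weight are nonnegative, so
the term at `l₀` alone bounds the sum from below. With `ε = 0` this says that averaging preserves an
interval; with `ε > 0` the length of the interval shrinks by the factor `1 - ε`. -/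
theorem average_mem_Icc {Ω : Type*} [Fintype Ω] {w v : Ω → ℝ} {α β ε : ℝ}
    (hw : ∀ l, 0 ≤ w l) (hw1 : ∑ l, w l = 1)
    (hv : ∀ l, 0 < w l → v l ∈ Set.Icc α β) {l₀ : Ω} (hε : ε ≤ w l₀) (h₀ : v l₀ ∈ Set.Icc α β) :
    ∑ l, w l * v l ∈ Set.Icc (ε * v l₀ + (1 - ε) * α) (ε * v l₀ + (1 - ε) * β) := by
  have key : ∀ u : Ω → ℝ, (∀ l, 0 < w l → 0 ≤ u l) → 0 ≤ u l₀ → ε * u l₀ ≤ ∑ l, w l * u l := by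
    intro u hu hu0
    refine (mul_le_mul_of_nonneg_right hε hu0).trans
      (Finset.single_le_sum (f := fun l => w l * u l) (fun l _ => ?_) (Finset.mem_univ l₀))
    rcases (hw l).eq_or_lt with h | h
    · simp [← h]
    · exact mul_nonneg h.le (hu l h)
  have h1 := key (fun l => v l - α) (fun l hl => sub_nonneg.2 (hv l hl).1) (sub_nonneg.2 h₀.1)
  have h2 := key (fun l => β - v l) (fun l hl => sub_nonneg.2 (hv l hl).2) (sub_nonneg.2 h₀.2)
  simp only [mul_sub, Finset.sum_sub_distrib, ← Finset.sum_mul, hw1] at h1 h2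
  constructor <;> linarith

namespace CyclicStructure

variable (D : CyclicStructure P)

/-- A converse of `pow_pos_trans` in high powers, since the phase conditions subtract. It ensures
that the averages below only involve positive entries of column `j`. -/
theorem pos_of_pos_add {n m : ℕ} {i l j : Ω} (hm : D.bound ≤ m)
    (h : 0 < ((P : Matrix Ω Ω ℝ) ^ (n + m)) i j) (hn : 0 < ((P : Matrix Ω Ω ℝ) ^ n) i l) :
    0 < ((P : Matrix Ω Ω ℝ) ^ m) l j := by
  refine D.pos_of_dvd hm ?_
  obtain ⟨x, hx⟩ := D.dvd_of_pos h
  obtain ⟨y, hy⟩ := D.dvd_of_pos hn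
  push_cast at hx
  exact ⟨x - y, by linear_combination hx - hy⟩

/-- Column `j` of `P ^ (n + m)` consists of averages of column `j` of `P ^ m`, and a row that
reaches `j` only gives weight to states in the support of that column. -/
theorem pow_add_mem_Icc {m : ℕ} {j : Ω} {α β : ℝ} (hm : D.bound ≤ m)
    (h : ∀ l, 0 < ((P : Matrix Ω Ω ℝ) ^ m) l j → ((P : Matrix Ω Ω ℝ) ^ m) l j ∈ Set.Icc α β)
    (n : ℕ) {i : Ω} (hi : 0 < ((P : Matrix Ω Ω ℝ) ^ (n + m)) i j) :
    ((P : Matrix Ω Ω ℝ) ^ (n + m)) i j ∈ Set.Icc α β := by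
  obtain ⟨l₀, -, hl₀⟩ : ∃ l ∈ Finset.univ, 0 < ((P : Matrix Ω Ω ℝ) ^ n) i l :=
    Finset.exists_lt_of_sum_lt (by simp [sum_pow_apply])
  have hv : ∀ l, 0 < ((P : Matrix Ω Ω ℝ) ^ n) i l →
    ((P : Matrix Ω Ω ℝ) ^ m) l j ∈ Set.Icc α β := fun l hl => h l (D.pos_of_pos_add hm hi hl)
  have := average_mem_Icc (ε := 0) (pow_nonneg_apply P n i) (sum_pow_apply P n i) hv hl₀.le
    (hv l₀ hl₀)
  rw [pow_add, Matrix.mul_apply]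
  simpa using this

/-- The oscillation of the positive entries of a column contracts. -/
theorem exists_contraction : ∃ q : ℝ, 0 ≤ q ∧ q < 1 ∧ ∀ (m : ℕ) (j : Ω) (α β : ℝ), D.bound ≤ m →
    α ≤ β →
    (∀ l, 0 < ((P : Matrix Ω Ω ℝ) ^ m) l j → ((P : Matrix Ω Ω ℝ) ^ m) l j ∈ Set.Icc α β) →
    ∃ α' β', α' ≤ β' ∧ β' - α' ≤ q * (β - α) ∧
      ∀ i, 0 < ((P : Matrix Ω Ω ℝ) ^ (D.bound + m)) i j →
        ((P : Matrix Ω Ω ℝ) ^ (D.bound + m)) i j ∈ Set.Icc α' β' := by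
  obtain ⟨δ, hδ, hδP⟩ := exists_pos_le_of_pos fun p : Ω × Ω =>
    ((P : Matrix Ω Ω ℝ) ^ D.bound) p.1 p.2
  -- Every row that reaches `j` gives weight at least `δ` to the same state `l₀`, as in Doeblin's
  -- argument. The minimum with `1` keeps the factor nonnegative.
  refine ⟨1 - min δ 1, by simp, by simpa using hδ, fun m j α β hm hαβ h => ?_⟩
  by_cases he : ∃ l, 0 < ((P : Matrix Ω Ω ℝ) ^ m) l j
  · obtain ⟨l₀, hl₀⟩ := he
    set ε := min δ 1
    have hε : ε ≤ 1 := min_le_right _ _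
    refine ⟨ε * ((P : Matrix Ω Ω ℝ) ^ m) l₀ j + (1 - ε) * α,
      ε * ((P : Matrix Ω Ω ℝ) ^ m) l₀ j + (1 - ε) * β, ?_, by linarith, fun i hi => ?_⟩
    · gcongr
    · have hil : 0 < ((P : Matrix Ω Ω ℝ) ^ D.bound) i l₀ := by
        refine D.pos_of_dvd le_rfl ?_
        obtain ⟨x, hx⟩ := D.dvd_of_pos hi
        obtain ⟨y, hy⟩ := D.dvd_of_pos hl₀
        push_cast at hx
        exact ⟨x - y, by linear_combination hx - hy⟩
      rw [pow_add, Matrix.mul_apply]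
      exact average_mem_Icc (pow_nonneg_apply P _ i) (sum_pow_apply P _ i)
        (fun l hl => h l (D.pos_of_pos_add hm hi hl))
        ((min_le_left _ _).trans (hδP (i, l₀) hil)) (h l₀ hl₀)
  -- If column `j` of `P ^ m` has no positive entry, the later column has none either, and any
  -- interval will do.
  · refine ⟨0, 0, le_rfl, by simpa using mul_nonneg (by simp) (sub_nonneg.2 hαβ), fun i hi => ?_⟩
    obtain ⟨l, -, hl⟩ : ∃ l ∈ Finset.univ, 0 < ((P : Matrix Ω Ω ℝ) ^ D.bound) i l :=
      Finset.exists_lt_of_sum_lt (by simp [sum_pow_apply])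
    exact (he ⟨l, D.pos_of_pos_add hm hi hl⟩).elim

/-- The positive entries of a column of `P ^ m` get close to each other as `m → ∞`. -/
theorem exists_forall_abs_sub_le (D : CyclicStructure P) (j : Ω) {η : ℝ} (hη : 0 < η) :
    ∃ M, ∀ m ≥ M, ∀ m' ≥ M, ∀ i i',
    0 < ((P : Matrix Ω Ω ℝ) ^ m) i j → 0 < ((P : Matrix Ω Ω ℝ) ^ m') i' j →
      |((P : Matrix Ω Ω ℝ) ^ m) i j - ((P : Matrix Ω Ω ℝ) ^ m') i' j| ≤ η := by
  obtain ⟨q, hq0, hq1, hq⟩ := D.exists_contraction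
  have hle1 : ∀ m i, ((P : Matrix Ω Ω ℝ) ^ m) i j ≤ 1 := fun m i =>
    (Finset.single_le_sum (f := fun l => ((P : Matrix Ω Ω ℝ) ^ m) i l)
      (fun l _ => pow_nonneg_apply P m i l) (Finset.mem_univ j)).trans_eq (sum_pow_apply P m i)
  have step : ∀ k : ℕ, ∃ m ≥ D.bound, ∃ α β, α ≤ β ∧ β - α ≤ q ^ k ∧
      ∀ l, 0 < ((P : Matrix Ω Ω ℝ) ^ m) l j → ((P : Matrix Ω Ω ℝ) ^ m) l j ∈ Set.Icc α β := by
    intro k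
    induction k with
    | zero => exact ⟨D.bound, le_rfl, 0, 1, zero_le_one, by simp, fun l hl => ⟨hl.le, hle1 _ _⟩⟩
    | succ k ih =>
      obtain ⟨m, hm, α, β, hαβ, hk, h⟩ := ih
      obtain ⟨α', β', h', hk', hI⟩ := hq m j α β hm hαβ h
      refine ⟨D.bound + m, Nat.le_add_right _ _, α', β', h', hk'.trans ?_, hI⟩
      rw [pow_succ']
      gcongr
  obtain ⟨k, hk⟩ := exists_pow_lt_of_lt_one hη hq1
  obtain ⟨M, hM, α, β, -, hle, h⟩ := step k
  -- One interval, found at the single power `M`, serves all later powers and hence all residue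
  -- classes at once.
  have hI : ∀ m ≥ M, ∀ i, 0 < ((P : Matrix Ω Ω ℝ) ^ m) i j →
      ((P : Matrix Ω Ω ℝ) ^ m) i j ∈ Set.Icc α β := by
    intro m hm i hi
    obtain ⟨n, rfl⟩ := Nat.exists_eq_add_of_le' hm
    exact D.pow_add_mem_Icc hM h n hi
  refine ⟨M, fun m hm m' hm' i i' hi hi' => ?_⟩
  have h1 := hI m hm i hi
  have h2 := hI m' hm' i' hi'
  rw [abs_le]
  constructor <;> linarith [h1.1, h1.2, h2.1, h2.2]

/-- Averaging cannot lower the least positive entry. The bound controls the denominators in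
`tendsto_coeff`. -/
theorem exists_pos_forall_le (j : Ω) : ∃ δ > 0, ∀ m ≥ D.bound, ∀ i,
    0 < ((P : Matrix Ω Ω ℝ) ^ m) i j → δ ≤ ((P : Matrix Ω Ω ℝ) ^ m) i j := by
  obtain ⟨δ, hδ, h⟩ := exists_pos_le_of_pos fun i => ((P : Matrix Ω Ω ℝ) ^ D.bound) i j
  refine ⟨δ, hδ, fun m hm i hi => ?_⟩
  obtain ⟨n, rfl⟩ := Nat.exists_eq_add_of_le' hm
  refine (D.pow_add_mem_Icc (β := ∑ l, ((P : Matrix Ω Ω ℝ) ^ D.bound) l j) le_rfl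
    (fun l hl => ⟨h l hl, ?_⟩) n hi).1
  exact Finset.single_le_sum (f := fun l => ((P : Matrix Ω Ω ℝ) ^ D.bound) l j)
    (fun l _ => pow_nonneg_apply P _ l j) (Finset.mem_univ l)

/-- The coefficients of the subproduct maps converge. -/
theorem tendsto_coeff (D : CyclicStructure P) (n : ℕ) (i l j : Ω) :
    Tendsto (fun k => coeff P n k i l j) (atTop ⊓ 𝓟 {k | 0 < ((P : Matrix Ω Ω ℝ) ^ k) l j})
      (𝓝 √(((P : Matrix Ω Ω ℝ) ^ n) i l)) := by
  rcases (pow_nonneg_apply P n i l).eq_or_lt with h0 | h0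
  · have : ∀ k, coeff P n k i l j = 0 := fun k => by simp [coeff_def, ← h0]
    simp [this, ← h0, tendsto_const_nhds]
  obtain ⟨δ, hδ, hδP⟩ := D.exists_pos_forall_le j
  have hratio : Tendsto (fun k => ((P : Matrix Ω Ω ℝ) ^ k) l j / ((P : Matrix Ω Ω ℝ) ^ (n + k)) i j)
      (atTop ⊓ 𝓟 {k | 0 < ((P : Matrix Ω Ω ℝ) ^ k) l j}) (𝓝 1) := by
    refine Metric.tendsto_nhds.2 fun ε hε => ?_
    -- Numerator and denominator are positive entries of one column, in different rows and powers. A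
    -- difference of at most `δ * (ε / 2)` over a denominator of at least `δ` puts the quotient
    -- within `ε / 2` of `1`.
    obtain ⟨M, hM⟩ := D.exists_forall_abs_sub_le j (η := δ * (ε / 2)) (by positivity)
    rw [eventually_inf_principal]
    filter_upwards [eventually_ge_atTop (max M D.bound)] with k hk hkl
    have hki := pow_pos_trans h0 hkl
    have h1 := hM k (le_of_max_le_left hk) (n + k) (by have := le_of_max_le_left hk; omega) l i
      hkl hki
    have h2 := hδP (n + k) (by have := le_of_max_le_right hk; omega) i hki
    rw [Real.dist_eq, div_sub_one hki.ne', abs_div, abs_of_pos hki, div_lt_iff₀ hki]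
    nlinarith
  have := (hratio.sqrt.const_mul √(((P : Matrix Ω Ω ℝ) ^ n) i l))
  rw [Real.sqrt_one, mul_one] at this
  refine this.congr' ?_
  rw [EventuallyEq, eventually_inf_principal]
  refine .of_forall fun k hkl => ?_
  have hki := pow_pos_trans h0 hkl
  rw [coeff_def, if_pos (Real.sqrt_pos.2 hki), Real.sqrt_div hkl.le]
  ring

end CyclicStructure
end StochasticMatrix

/-! ### `L²` estimates on the circle -/

section FourierCoeff

open AddCircle MeasureTheory

variable {T : ℝ} [Fact (0 < T)]

theorem ContinuousMap.integrable_haarAddCircle (φ : C(AddCircle T, ℂ)) :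
    Integrable φ haarAddCircle :=
  φ.continuous.integrable_of_hasCompactSupport (.of_compactSpace _)

/-- Parseval's identity for a continuous function. -/
theorem ContinuousMap.hasSum_sq_fourierCoeff (φ : C(AddCircle T, ℂ)) :
    HasSum (fun t => ‖fourierCoeff φ t‖ ^ 2) (∫ x, ‖φ x‖ ^ 2 ∂haarAddCircle) := by
  have h := _root_.hasSum_sq_fourierCoeff (ContinuousMap.toLp 2 haarAddCircle ℂ φ)
  simp only [fourierCoeff_toLp] at h
  convert h using 1
  refine integral_congr_ae ?_
  filter_upwards [ContinuousMap.coeFn_toLp (p := 2) (𝕜 := ℂ) haarAddCircle φ] with x hx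
  rw [hx]

theorem ContinuousMap.integral_sq_le (φ : C(AddCircle T, ℂ)) :
    ∫ x, ‖φ x‖ ^ 2 ∂haarAddCircle ≤ ‖φ‖ ^ 2 := by
  have h : ∫ x, ‖φ x‖ ^ 2 ∂haarAddCircle ≤ ∫ _, ‖φ‖ ^ 2 ∂(haarAddCircle (T := T)) := by
    refine integral_mono ?_ (integrable_const _) fun x => ?_
    · exact (φ.continuous.norm.pow 2).integrable_of_hasCompactSupport (.of_compactSpace _)
    · simp only
      gcongr
      exact φ.norm_coe_le_norm x
  simpa using h

/-- A continuous function is bounded pointwise by `C` if multiplication by it is bounded by `C` in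
the norm of `L²`. -/
theorem ContinuousMap.norm_apply_le_of_integral_sq_le (f : C(AddCircle T, ℂ)) {C : ℝ} (hC : 0 ≤ C)
    (h : ∀ φ : C(AddCircle T, ℂ), ∫ x, ‖(f * φ) x‖ ^ 2 ∂haarAddCircle ≤
      C ^ 2 * ∫ x, ‖φ x‖ ^ 2 ∂haarAddCircle) (x : AddCircle T) : ‖f x‖ ≤ C := by
  -- Test with `φ = √w`, where `w` is the positive part of `‖f‖ ^ 2 - C ^ 2`: the hypothesis becomes
  -- `∫ w ^ 2 ≤ 0`, which forces `w = 0`.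
  let w : C(AddCircle T, ℝ) := ⟨fun x => max (‖f x‖ ^ 2 - C ^ 2) 0, by fun_prop⟩
  have hw : ∀ x, 0 ≤ w x := fun x => le_max_right _ _
  let φ : C(AddCircle T, ℂ) := ⟨fun x => (√(w x) : ℂ), by fun_prop⟩
  have hφ : ∀ x, ‖φ x‖ ^ 2 = w x := fun x => by
    simp only [φ, ContinuousMap.coe_mk, Complex.norm_real, Real.norm_eq_abs, sq_abs]
    exact Real.sq_sqrt (hw x)
  have hint : ∀ u : AddCircle T → ℝ, Continuous u → Integrable u haarAddCircle := fun u hu =>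
    hu.integrable_of_hasCompactSupport (.of_compactSpace _)
  have h1 := h φ
  simp only [ContinuousMap.mul_apply, norm_mul, mul_pow, hφ] at h1
  rw [← integral_const_mul, ← sub_nonpos, ← integral_sub (hint _ (by fun_prop))
    (hint _ (by fun_prop))] at h1
  have h2 : ∀ x, ‖f x‖ ^ 2 * w x - C ^ 2 * w x = w x ^ 2 := fun x => by
    rw [← sub_mul, pow_two (w x)]
    rcases le_total (‖f x‖ ^ 2 - C ^ 2) 0 with h | h
    · simp [w, max_eq_right h]
    · simp [w, max_eq_left h]
  simp only [h2] at h1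
  have h3 : (∫ x, w x ^ 2 ∂haarAddCircle) = 0 :=
    le_antisymm h1 (integral_nonneg fun x => by positivity)
  have h4 := (Continuous.integral_pos_of_hasCompactSupport_nonneg_nonzero
    (μ := haarAddCircle (T := T)) (f := fun x => w x ^ 2) (x := x) (by fun_prop)
    (.of_compactSpace _) (fun x => by positivity)).mt (by rw [h3]; simp)
  have h5 : w x = 0 := by simpa using h4
  have h6 : ‖f x‖ ^ 2 - C ^ 2 ≤ 0 := (le_max_left _ _).trans_eq h5
  exact le_of_sq_le_sq (by linarith) hC

end FourierCoeff

/-! ### Matrix units and embedded function vectors -/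

namespace StochasticMatrix

open CStarModule Matrix Fock

variable {Ω : Type*} [Fintype Ω] [DecidableEq Ω] {P : rowStochastic ℝ Ω}

namespace Fock

theorem comp_sum {ι : Type*} (s : Finset ι) (y : ι → Fock P) (k : ℕ) :
    (∑ i ∈ s, y i).comp k = ∑ i ∈ s, (y i).comp k :=
  map_sum (AddMonoidHom.mk' (fun y : Fock P => y.comp k) fun _ _ => rfl) y s

variable (P) in
/-- The matrix unit `(i, j)` in the fibre of degree `n`, or `0` if it is not in the fibre. -/
noncomputable def unit (n : ℕ) (i j : Ω) : Fock P :=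
  mk (fun k => of fun i' j' => if 0 < ((P : Matrix Ω Ω ℝ) ^ n) i j ∧ k = n ∧ i' = i ∧ j' = j
      then 1 else 0)
    (fun k i' j' h => by
      simp only [of_apply, ite_eq_right_iff]
      rintro ⟨h', rfl, rfl, rfl⟩
      exact (h h').elim)
    (fun j' => summable_of_ne_finset_zero (s := {n}) fun k hk => by
      have : k ≠ n := by simpa using hk
      simp [colSq, this])

theorem comp_unit (n k : ℕ) (i j i' j' : Ω) : (unit P n i j).comp k i' j' =
    if 0 < ((P : Matrix Ω Ω ℝ) ^ n) i j ∧ k = n ∧ i' = i ∧ j' = j then 1 else 0 := rfl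

theorem unit_eq_zero {n : ℕ} {i j : Ω} (h : ¬ 0 < ((P : Matrix Ω Ω ℝ) ^ n) i j) :
    unit P n i j = 0 := by
  ext k i' j'
  simp [comp_unit, h]

theorem norm_unit_le (n : ℕ) (i j : Ω) : ‖unit P n i j‖ ≤ 1 := by
  refine (norm_le_iff _ zero_le_one).2 fun j' => ?_
  have h0 : ∀ k ≠ n, colSq ((unit P n i j).comp k) j' = 0 := fun k hk => by
    simp [colSq, comp_unit, hk]
  rw [totSq, tsum_eq_single n h0, colSq, Finset.sum_eq_single i]
  · rw [comp_unit]
    split_ifs <;> simp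
  · intro i' _ hi'
    simp [comp_unit, hi']
  · simp

end Fock

namespace CyclicStructure

variable (D : CyclicStructure P)

/-- The degrees `n` for which `(i, j)` is in the support of `P ^ n` are `D.degree i j t`, `t ∈ ℤ`,
up to finitely many. -/
def degree (i j : Ω) (t : ℤ) : ℕ := (D.period * t + D.phase i - D.phase j).toNat

/-- The inverse of `D.degree i j`. -/
def index (i j : Ω) (n : ℕ) : ℤ := (n + D.phase j - D.phase i) / D.period

theorem period_mul_index {i j : Ω} {n : ℕ} (h : 0 < ((P : Matrix Ω Ω ℝ) ^ n) i j) :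
    D.period * D.index i j n = n + D.phase j - D.phase i := Int.mul_ediv_cancel' (D.dvd_of_pos h)

theorem degree_index {i j : Ω} {n : ℕ} (h : 0 < ((P : Matrix Ω Ω ℝ) ^ n) i j) :
    D.degree i j (D.index i j n) = n := by
  rw [degree, D.period_mul_index h]
  omega

theorem injOn_index (i j : Ω) :
    Set.InjOn (D.index i j) {n | 0 < ((P : Matrix Ω Ω ℝ) ^ n) i j} := fun n hn m hm h => by
  rw [← D.degree_index hn, h, D.degree_index hm]

theorem tendsto_period_mul (z : ℤ) : Tendsto (fun t : ℤ => D.period * t + z) atTop atTop :=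
  tendsto_atTop_add_const_right _ _
    (tendsto_id.const_mul_atTop' (Int.natCast_pos.2 D.period_pos))

theorem eventually_degree (i j : Ω) : ∀ᶠ t in atTop,
    (D.degree i j t : ℤ) = D.period * t + D.phase i - D.phase j ∧
      0 < ((P : Matrix Ω Ω ℝ) ^ D.degree i j t) i j := by
  filter_upwards [(D.tendsto_period_mul (D.phase i - D.phase j)).eventually_ge_atTop
    (D.bound : ℤ)] with t ht
  have h : (D.degree i j t : ℤ) = D.period * t + D.phase i - D.phase j := by
    rw [degree]
    omega
  refine ⟨h, D.pos_of_dvd (by omega) ⟨t, ?_⟩⟩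
  rw [h]
  ring

theorem tendsto_degree (i j : Ω) : Tendsto (D.degree i j) atTop atTop := by
  refine tendsto_atTop.2 fun N => ?_
  filter_upwards [(D.tendsto_period_mul (D.phase i - D.phase j)).eventually_ge_atTop
    (N : ℤ)] with t ht
  rw [degree]
  omega

theorem index_degree {i j : Ω} {t : ℤ}
    (h : (D.degree i j t : ℤ) = D.period * t + D.phase i - D.phase j) :
    D.index i j (D.degree i j t) = t := by
  rw [index, h]
  refine Int.ediv_eq_of_eq_mul_right (by exact_mod_cast D.period_pos.ne') ?_
  ring

theorem tendsto_natCast_add (t : ℤ) : Tendsto (fun m : ℕ => (m : ℤ) + t) atTop atTop :=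
  tendsto_atTop_add_const_right _ _ tendsto_natCast_atTop_atTop

/-! ### Vectors of functions on the circle as vectors of the Fock module -/

open AddCircle MeasureTheory

/-- The entries of `D.embed j m g`. -/
noncomputable def embedEntry (j : Ω) (m : ℕ) (g : Ω → C(UnitAddCircle, ℂ)) (n : ℕ) (i : Ω) : ℂ :=
  if 0 < ((P : Matrix Ω Ω ℝ) ^ n) i j then fourierCoeff (g i) (D.index i j n - m) else 0

/-- Distinct degrees in the support have distinct indices, so the entries are a subfamily of the
Fourier coefficients of `g i` and Parseval's identity applies. -/
theorem summable_embedEntry (j : Ω) (m : ℕ) (g : Ω → C(UnitAddCircle, ℂ)) (i : Ω) :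
    (Summable fun n => ‖D.embedEntry j m g n i‖ ^ 2) ∧
      ∑' n, ‖D.embedEntry j m g n i‖ ^ 2 ≤ ∫ x, ‖g i x‖ ^ 2 ∂haarAddCircle := by
  let S := {n | 0 < ((P : Matrix Ω Ω ℝ) ^ n) i j}
  have hinj : Function.Injective fun n : S => D.index i j n - m := fun n n' h =>
    Set.injOn_iff_injective.1 (D.injOn_index i j) (sub_left_injective h)
  have hs := (g i).hasSum_sq_fourierCoeff
  have hsupp : Function.support (fun n => ‖D.embedEntry j m g n i‖ ^ 2) ⊆ S := fun n hn => by
    by_contra h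
    have h : ¬ 0 < ((P : Matrix Ω Ω ℝ) ^ n) i j := h
    simp [embedEntry, h] at hn
  have he : ∀ n : S, ‖D.embedEntry j m g n i‖ ^ 2 = ‖fourierCoeff (g i) (D.index i j n - m)‖ ^ 2 :=
    fun n => by
      have h : 0 < ((P : Matrix Ω Ω ℝ) ^ (n : ℕ)) i j := n.2
      simp [embedEntry, h]
  refine ⟨?_, ?_⟩
  · have := (summable_subtype_iff_indicator (f := fun n => ‖D.embedEntry j m g n i‖ ^ 2)).1
      ((hs.summable.comp_injective hinj).congr fun n => (he n).symm)
    rwa [Set.indicator_eq_self.2 hsupp] at this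
  · rw [← tsum_subtype_eq_of_support_subset hsupp, ← hs.tsum_eq]
    simp only [he]
    exact tsum_comp_le_tsum_of_inj hs.summable (fun _ => by positivity) hinj

/-- The vector of the Fock module in the column `j` whose entries are the Fourier coefficients of
`g`, moved by `m` steps; the coefficients that are moved below degree `0` are dropped. -/
noncomputable def embed (j : Ω) (m : ℕ) : (Ω → C(UnitAddCircle, ℂ)) →ₗ[ℂ] Fock P where
  toFun g := Fock.mk (fun n => of fun i j' => if j' = j then D.embedEntry j m g n i else 0)
    (fun n i j' h => by
      simp only [of_apply, ite_eq_right_iff]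
      rintro rfl
      simp [embedEntry, h])
    (fun j' => by
      by_cases h : j' = j
      · simpa [colSq, h] using summable_sum fun i _ => (D.summable_embedEntry j m g i).1
      · simp [colSq, h, summable_zero])
  map_add' g g' := by
    ext n i j'
    simp only [comp_mk, of_apply, comp_add, Matrix.add_apply, embedEntry, Pi.add_apply]
    split_ifs
    · exact congrFun (fourierCoeff.add (g i).integrable_haarAddCircle
        (g' i).integrable_haarAddCircle) _
    all_goals simp
  map_smul' z g := by
    ext n i j'
    simp only [comp_mk, of_apply, comp_smul, Matrix.smul_apply, embedEntry, Pi.smul_apply,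
      RingHom.id_apply]
    split_ifs
    · exact fourierCoeff.const_smul _ _ _
    all_goals simp

theorem comp_embed (j : Ω) (m : ℕ) (g : Ω → C(UnitAddCircle, ℂ)) (n : ℕ) (i j' : Ω) :
    (D.embed j m g).comp n i j' = if j' = j then D.embedEntry j m g n i else 0 := rfl

theorem totSq_embed (j : Ω) (m : ℕ) (g : Ω → C(UnitAddCircle, ℂ)) (j' : Ω) :
    (D.embed j m g).totSq j' =
      if j' = j then ∑ i, ∑' n, ‖D.embedEntry j m g n i‖ ^ 2 else 0 := by
  by_cases h : j' = j
  · simp only [totSq, colSq, comp_embed, h, if_true]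
    exact Summable.tsum_finsetSum fun i _ => (D.summable_embedEntry j m g i).1
  · simp [totSq, colSq, comp_embed, h]

theorem norm_embed_le (j : Ω) (m : ℕ) (g : Ω → C(UnitAddCircle, ℂ)) :
    ‖D.embed j m g‖ ≤ √(∑ i, ∫ x, ‖g i x‖ ^ 2 ∂haarAddCircle) := by
  have h0 : 0 ≤ ∑ i, ∫ x, ‖g i x‖ ^ 2 ∂haarAddCircle :=
    Finset.sum_nonneg fun i _ => integral_nonneg fun x => by positivity
  refine (norm_le_iff _ (Real.sqrt_nonneg _)).2 fun j' => ?_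
  rw [Real.sq_sqrt h0, totSq_embed]
  split_ifs
  · exact Finset.sum_le_sum fun i _ => (D.summable_embedEntry j m g i).2
  · exact h0

theorem norm_embed_le_norm (j : Ω) (m : ℕ) (g : Ω → C(UnitAddCircle, ℂ)) :
    ‖D.embed j m g‖ ≤ √(Fintype.card Ω) * ‖g‖ := by
  refine (D.norm_embed_le j m g).trans ?_
  rw [Real.sqrt_le_left (by positivity), mul_pow, Real.sq_sqrt (by positivity)]
  calc ∑ i, ∫ x, ‖g i x‖ ^ 2 ∂haarAddCircle ≤ ∑ i : Ω, ‖g‖ ^ 2 := by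
        refine Finset.sum_le_sum fun i _ => (g i).integral_sq_le.trans ?_
        gcongr
        exact norm_le_pi_norm g i
    _ = _ := by simp

/-- An asymptotic upper bound of the embedded vectors is an upper bound of the `L²`-norms. -/
theorem integral_sq_le_of_norm_embed_le (j : Ω) (g : Ω → C(UnitAddCircle, ℂ)) {C : ℝ} (hC : 0 ≤ C)
    (h : ∀ ε > 0, ∀ᶠ m in atTop, ‖D.embed j m g‖ ≤ C + ε) (i : Ω) :
    ∫ x, ‖g i x‖ ^ 2 ∂haarAddCircle ≤ C ^ 2 := by
  have hs := (g i).hasSum_sq_fourierCoeff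
  refine hasSum_le_of_sum_le hs fun F => ?_
  have key : ∀ ε > 0, ∑ t ∈ F, ‖fourierCoeff (g i) t‖ ^ 2 ≤ (C + ε) ^ 2 := by
    intro ε hε
    -- Finitely many frequencies all survive the truncation at degree `0` once `m` is large.
    have hF : ∀ᶠ m : ℕ in atTop, ∀ t ∈ F,
        (D.degree i j (m + t) : ℤ) = D.period * (m + t) + D.phase i - D.phase j ∧
          0 < ((P : Matrix Ω Ω ℝ) ^ D.degree i j (m + t)) i j :=
      (Finset.eventually_all F).2 fun t _ =>
        (tendsto_natCast_add t).eventually (D.eventually_degree i j)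
    obtain ⟨m, hm, hmF⟩ := ((h ε hε).and hF).exists
    have h1 := (norm_le_iff _ (by positivity)).1 hm j
    rw [totSq_embed, if_pos rfl] at h1
    refine le_trans ?_ h1
    refine le_trans ?_ (Finset.single_le_sum
      (f := fun i => ∑' n, ‖D.embedEntry j m g n i‖ ^ 2)
      (fun i _ => tsum_nonneg fun n => by positivity) (Finset.mem_univ i))
    have hinj : Set.InjOn (fun t : ℤ => D.degree i j (m + t)) F := fun t ht t' ht' he => by
      have := congrArg (D.index i j) he
      simp only [D.index_degree (hmF t ht).1, D.index_degree (hmF t' ht').1] at this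
      linarith
    refine le_trans (le_of_eq ?_) ((D.summable_embedEntry j m g i).1.sum_le_tsum
      (F.image fun t : ℤ => D.degree i j (m + t)) fun n _ => by positivity)
    rw [Finset.sum_image hinj]
    refine Finset.sum_congr rfl fun t ht => ?_
    rw [embedEntry, if_pos (hmF t ht).2, D.index_degree (hmF t ht).1, add_sub_cancel_left]
  have hlim : Tendsto (fun ε => (C + ε) ^ 2) (𝓝[>] 0) (𝓝 (C ^ 2)) := by
    have : Continuous fun ε : ℝ => (C + ε) ^ 2 := by fun_prop
    simpa using (this.tendsto 0).mono_left nhdsWithin_le_nhds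
  exact ge_of_tendsto hlim (eventually_mem_nhdsWithin.mono fun ε hε => key ε hε)

/-- The dictionary between the two pictures: a monomial has a single Fourier coefficient, which for
large `m` lands in a genuine degree. -/
theorem embed_single_fourier (j l : Ω) (t : ℤ) : ∀ᶠ m : ℕ in atTop,
    D.embed j m (Pi.single l (fourier t)) = unit P (D.degree l j (m + t)) l j := by
  filter_upwards [(tendsto_natCast_add t).eventually (D.eventually_degree l j)] with m hm
  ext n i j'
  rw [comp_embed, comp_unit, embedEntry]
  by_cases hj : j' = j
  · by_cases hi : i = l
    · subst hi
      by_cases hn : n = D.degree i j (m + t)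
      · simp [hj, hn, hm.2, D.index_degree hm.1, fourierCoeff_fourier]
      · have : 0 < ((P : Matrix Ω Ω ℝ) ^ n) i j → D.index i j n - m ≠ t := fun h h' => by
          refine hn ?_
          rw [← h', add_sub_cancel, D.degree_index h]
        simp only [hj, if_true, hn, Pi.single_eq_same, fourierCoeff_fourier]
        split_ifs with h <;> simp_all
    · simp [hi, fourierCoeff]
  · simp [hj]

end CyclicStructure
end StochasticMatrix

/-! ### Symbols of operators -/

namespace StochasticMatrix

open CStarModule Matrix Fock AddCircle MeasureTheory

variable {Ω : Type*} [Fintype Ω] [DecidableEq Ω] {P : rowStochastic ℝ Ω}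

namespace CyclicStructure

variable (D : CyclicStructure P)

/-- The operator `T` acts in high degrees like multiplication by the matrix `f` of functions on the
circle. -/
def HasSymbol (T : Adjointable (Ω → ℂ) (Fock P)) (f : Matrix Ω Ω C(UnitAddCircle, ℂ)) : Prop :=
  ∀ j g, Tendsto (fun m : ℕ => T.1 (D.embed j m g) - D.embed j m (f *ᵥ g)) atTop (𝓝 0)

variable {D}

namespace HasSymbol

variable {S T : Adjointable (Ω → ℂ) (Fock P)} {e f : Matrix Ω Ω C(UnitAddCircle, ℂ)}

theorem algebraMap (z : ℂ) : D.HasSymbol (algebraMap ℂ _ z) (algebraMap ℂ _ z) := fun j g => by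
  refine tendsto_const_nhds.congr fun m => ?_
  rw [Algebra.algebraMap_eq_smul_one, Algebra.algebraMap_eq_smul_one, smul_mulVec, one_mulVec,
    map_smul, Adjointable.smul_apply]
  exact (sub_self _).symm

theorem zero : D.HasSymbol 0 0 := fun j g => by
  refine tendsto_const_nhds.congr fun m => ?_
  rw [zero_mulVec, map_zero, sub_zero]
  rfl

theorem one : D.HasSymbol 1 1 := fun j g => by
  refine tendsto_const_nhds.congr fun m => ?_
  rw [one_mulVec]
  exact (sub_self _).symm

theorem add (hS : D.HasSymbol S e) (hT : D.HasSymbol T f) : D.HasSymbol (S + T) (e + f) :=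
  fun j g => by
    have h := (hS j g).add (hT j g)
    rw [add_zero] at h
    refine h.congr fun m => ?_
    rw [add_mulVec, map_add, Adjointable.add_apply]
    abel

theorem sub (hS : D.HasSymbol S e) (hT : D.HasSymbol T f) : D.HasSymbol (S - T) (e - f) :=
  fun j g => by
    have h := (hS j g).sub (hT j g)
    rw [sub_zero] at h
    refine h.congr fun m => ?_
    have : (S - T).1 (D.embed j m g) = S.1 (D.embed j m g) - T.1 (D.embed j m g) := rfl
    rw [sub_mulVec, map_sub, this]
    abel

/-- `T` turns the vector of `g` into that of `f *ᵥ g` up to a null sequence, which the continuity of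
`S` keeps null; then the symbol of `S` is used at `f *ᵥ g`. -/
theorem mul (hS : D.HasSymbol S e) (hT : D.HasSymbol T f) : D.HasSymbol (S * T) (e * f) :=
  fun j g => by
    have h := ((S.1.continuous.tendsto 0).comp (hT j g)).add (hS j (f *ᵥ g))
    rw [map_zero, add_zero] at h
    refine h.congr fun m => ?_
    simp only [Function.comp_apply, map_sub, mulVec_mulVec, Adjointable.mul_apply]
    abel

theorem eventually_norm_le (hT : D.HasSymbol T f) (j : Ω) (g : Ω → C(UnitAddCircle, ℂ)) {ε : ℝ}
    (hε : 0 < ε) : ∀ᶠ m in atTop, ‖D.embed j m (f *ᵥ g)‖ ≤ ‖T.1 (D.embed j m g)‖ + ε := by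
  have h := (hT j g).norm
  rw [norm_zero] at h
  filter_upwards [h.eventually (gt_mem_nhds hε)] with m hm
  have := norm_sub_norm_le (D.embed j m (f *ᵥ g)) (T.1 (D.embed j m g))
  rw [norm_sub_rev] at this
  linarith

/-- Testing on vectors concentrated in the coordinate `l` shows that multiplication by `f i l` is
bounded by `‖T‖` on `L²`, and the `L²` multiplier norm of a continuous function dominates its
supremum norm. -/
theorem norm_apply_le (hT : D.HasSymbol T f) (i l : Ω) : ‖f i l‖ ≤ ‖T‖ := by
  refine (ContinuousMap.norm_le _ (norm_nonneg T)).2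
    (ContinuousMap.norm_apply_le_of_integral_sq_le _ (norm_nonneg T) fun φ => ?_)
  set I := ∫ x, ‖φ x‖ ^ 2 ∂haarAddCircle with hI
  have hI0 : 0 ≤ I := integral_nonneg fun x => by positivity
  have hg : ∑ i, ∫ x, ‖(Pi.single l φ : Ω → C(UnitAddCircle, ℂ)) i x‖ ^ 2 ∂haarAddCircle = I := by
    rw [Finset.sum_eq_single l]
    · simp [hI]
    · intro i _ hi
      simp [hi]
    · simp
  have h := D.integral_sq_le_of_norm_embed_le l (f *ᵥ Pi.single l φ) (C := ‖T‖ * √I)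
    (by positivity) (fun ε hε => ?_) i
  · rwa [mulVec_single, Pi.smul_apply, op_smul_eq_mul, col_apply, mul_pow,
      Real.sq_sqrt hI0] at h
  · filter_upwards [hT.eventually_norm_le l (Pi.single l φ) hε] with m hm
    have h1 : ‖T.1 (D.embed l m (Pi.single l φ))‖ ≤ ‖T‖ * ‖D.embed l m (Pi.single l φ)‖ :=
      T.1.le_opNorm _
    have h2 := D.norm_embed_le l m (Pi.single l φ)
    rw [hg] at h2
    have h3 := mul_le_mul_of_nonneg_left h2 (norm_nonneg T)
    linarith

/-- The operator `T - T` has symbol `e - f` and norm `0`. -/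
theorem unique (he : D.HasSymbol T e) (hf : D.HasSymbol T f) : e = f := by
  ext1 i l
  have := (he.sub hf).norm_apply_le i l
  rw [sub_self, norm_zero, Matrix.sub_apply] at this
  exact sub_eq_zero.1 (norm_le_zero_iff.1 this)

end HasSymbol

theorem norm_mulVec_le {Ω : Type*} [Fintype Ω] (f : Matrix Ω Ω C(UnitAddCircle, ℂ))
    (g : Ω → C(UnitAddCircle, ℂ)) :
    ‖f *ᵥ g‖ ≤ (∑ i, ∑ l, ‖f i l‖) * ‖g‖ := by
  refine (pi_norm_le_iff_of_nonneg (by positivity)).2 fun i => ?_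
  calc ‖∑ l, f i l * g l‖ ≤ ∑ l, ‖f i l‖ * ‖g‖ :=
        norm_sum_le_of_le _ fun l _ => (norm_mul_le _ _).trans
          (mul_le_mul_of_nonneg_left (norm_le_pi_norm g l) (norm_nonneg _))
    _ = (∑ l, ‖f i l‖) * ‖g‖ := (Finset.sum_mul _ _ _).symm
    _ ≤ _ := mul_le_mul_of_nonneg_right (Finset.single_le_sum (f := fun i => ∑ l, ‖f i l‖)
        (fun i _ => by positivity) (Finset.mem_univ i)) (norm_nonneg _)

/-- It suffices to check the asymptotics of an operator on vectors `g` whose entries are Fourier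
monomials. -/
theorem hasSymbol_of_fourier {T : Adjointable (Ω → ℂ) (Fock P)}
    {f : Matrix Ω Ω C(UnitAddCircle, ℂ)} (h : ∀ j l t, Tendsto (fun m : ℕ =>
      T.1 (D.embed j m (Pi.single l (fourier t))) - D.embed j m (f *ᵥ Pi.single l (fourier t)))
        atTop (𝓝 0)) : D.HasSymbol T f := by
  intro j
  let R : ℕ → (Ω → C(UnitAddCircle, ℂ)) →ₗ[ℂ] Fock P := fun m =>
    T.1.toLinearMap ∘ₗ D.embed j m - D.embed j m ∘ₗ
      (mulVecLin f).restrictScalars ℂ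
  let K : Submodule ℂ (Ω → C(UnitAddCircle, ℂ)) :=
    { carrier := {g | Tendsto (fun m => R m g) atTop (𝓝 0)}
      add_mem' := fun {g g'} hg hg' => by
        have h : Tendsto (fun m => R m g + R m g') atTop (𝓝 (0 + 0)) := Tendsto.add hg hg'
        rw [add_zero] at h
        exact h.congr fun m => (map_add _ _ _).symm
      zero_mem' := by simp
      smul_mem' := fun z g hg => by
        have h : Tendsto (fun m => z • R m g) atTop (𝓝 (z • 0)) := Tendsto.const_smul hg z
        rw [smul_zero] at h
        exact h.congr fun m => (map_smul _ _ _).symm }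
  -- A bound on `R m` that is uniform in `m` makes `K` closed, so the density of the trigonometric
  -- polynomials suffices.
  obtain ⟨C, hC0, hC⟩ : ∃ C : ℝ, 0 ≤ C ∧ ∀ m g, ‖R m g‖ ≤ C * ‖g‖ := by
    refine ⟨‖T‖ * √(Fintype.card Ω) + √(Fintype.card Ω) * ∑ i, ∑ l, ‖f i l‖, by positivity,
      fun m g => (norm_sub_le _ _).trans ?_⟩
    rw [add_mul]
    refine add_le_add ?_ ?_
    · refine (T.1.le_opNorm _).trans ?_
      rw [mul_assoc]
      exact mul_le_mul_of_nonneg_left (D.norm_embed_le_norm j m g) (norm_nonneg T)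
    · refine (D.norm_embed_le_norm j m _).trans ?_
      rw [mul_assoc]
      exact mul_le_mul_of_nonneg_left (norm_mulVec_le f g) (Real.sqrt_nonneg _)
  have hKc : IsClosed (K : Set (Ω → C(UnitAddCircle, ℂ))) := by
    refine isClosed_of_closure_subset fun g hg => Metric.tendsto_atTop.2 fun ε hε => ?_
    obtain ⟨g', hg', hd⟩ := Metric.mem_closure_iff.1 hg (ε / (2 * (C + 1))) (by positivity)
    obtain ⟨N, hN⟩ := Metric.tendsto_atTop.1 hg' (ε / 2) (half_pos hε)
    refine ⟨N, fun m hm => ?_⟩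
    have h1 := hN m hm
    have h2 := hC m (g - g')
    rw [dist_zero_right] at h1 ⊢
    rw [dist_eq_norm, lt_div_iff₀ (by positivity)] at hd
    have h3 : R m g = R m (g - g') + R m g' := by rw [map_sub, sub_add_cancel]
    rw [h3]
    have := norm_add_le (R m (g - g')) (R m g')
    nlinarith [norm_nonneg (g - g')]
  have hsingle : ∀ l (φ : C(UnitAddCircle, ℂ)), (Pi.single l φ : Ω → C(UnitAddCircle, ℂ)) ∈ K := by
    intro l φ
    let L : Submodule ℂ C(UnitAddCircle, ℂ) :=
      K.comap (LinearMap.single ℂ (fun _ : Ω => C(UnitAddCircle, ℂ)) l)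
    have hL : IsClosed (L : Set C(UnitAddCircle, ℂ)) :=
      hKc.preimage (continuous_single l)
    have : (⊤ : Submodule ℂ C(UnitAddCircle, ℂ)) ≤ L := by
      rw [← span_fourier_closure_eq_top]
      refine Submodule.topologicalClosure_minimal _ (Submodule.span_le.2 ?_) hL
      rintro _ ⟨t, rfl⟩
      exact h j l t
    exact this (Submodule.mem_top (x := φ))
  intro g
  have hg : g ∈ K := by
    rw [← Finset.univ_sum_single g]
    exact K.sum_mem fun l _ => hsingle l (g l)
  exact hg

/-- The set of operators with a symbol such that the adjoint has the adjoint symbol is closed. -/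
theorem isClosed_setOf_hasSymbol : IsClosed {T : Adjointable (Ω → ℂ) (Fock P) |
    ∃ f, D.HasSymbol T f ∧ D.HasSymbol (star T) (star f)} := by
  refine isClosed_of_closure_subset fun T hT => ?_
  obtain ⟨u, hu, hlim⟩ := mem_closure_iff_seq_limit.1 hT
  choose f hf hfs using hu
  -- Symbols depend contractively on operators, entry by entry.
  have hc : ∀ i l, CauchySeq fun k => f k i l := fun i l => by
    refine Metric.cauchySeq_iff.2 fun ε hε => ?_
    obtain ⟨N, hN⟩ := Metric.cauchySeq_iff.1 hlim.cauchySeq ε hε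
    refine ⟨N, fun m hm n hn => ?_⟩
    have h1 := ((hf m).sub (hf n)).norm_apply_le i l
    have h2 := hN m hm n hn
    rw [dist_eq_norm] at h2 ⊢
    exact h1.trans_lt h2
  choose F hF using fun i l => cauchySeq_tendsto_of_complete (hc i l)
  -- Stated for arbitrary sequences because it is applied both to the operators and to their
  -- adjoints.
  have key : ∀ {u : ℕ → Adjointable (Ω → ℂ) (Fock P)} {T : Adjointable (Ω → ℂ) (Fock P)}
      {f : ℕ → Matrix Ω Ω C(UnitAddCircle, ℂ)} {F : Matrix Ω Ω C(UnitAddCircle, ℂ)},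
      Tendsto u atTop (𝓝 T) → (∀ i l, Tendsto (fun k => f k i l) atTop (𝓝 (F i l))) →
      (∀ k, D.HasSymbol (u k) (f k)) → D.HasSymbol T F := by
    intro u T f F hu hF hf j g
    refine Metric.tendsto_nhds.2 fun ε hε => ?_
    have h1 : Tendsto (fun k => ‖T - u k‖ * (√(Fintype.card Ω) * ‖g‖) +
        √(Fintype.card Ω) * ((∑ i, ∑ l, ‖(f k - F) i l‖) * ‖g‖)) atTop (𝓝 0) := by
      have a : Tendsto (fun k => ‖T - u k‖) atTop (𝓝 0) := by
        simpa using (tendsto_const_nhds (x := T)).sub hu |>.norm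
      have b : Tendsto (fun k => ∑ i, ∑ l, ‖(f k - F) i l‖) atTop (𝓝 0) := by
        have : Tendsto (fun k => ∑ i, ∑ l, ‖(f k - F) i l‖) atTop (𝓝 (∑ i : Ω, ∑ l : Ω, 0)) :=
          tendsto_finsetSum _ fun i _ => tendsto_finsetSum _ fun l _ => by
            simpa using ((hF i l).sub (tendsto_const_nhds (x := F i l))).norm
        simpa using this
      simpa using (a.mul_const _).add ((b.mul_const ‖g‖).const_mul √(Fintype.card Ω))
    obtain ⟨k, hk⟩ := (h1.eventually (gt_mem_nhds (half_pos hε))).exists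
    filter_upwards [Metric.tendsto_nhds.1 (hf k j g) (ε / 2) (half_pos hε)] with m hm
    rw [dist_zero_right] at hm ⊢
    have e : T.1 (D.embed j m g) - D.embed j m (F *ᵥ g) = (T - u k).1 (D.embed j m g) +
        D.embed j m ((f k - F) *ᵥ g) +
        ((u k).1 (D.embed j m g) - D.embed j m (f k *ᵥ g)) := by
      have : (T - u k).1 (D.embed j m g) = T.1 (D.embed j m g) - (u k).1 (D.embed j m g) := rfl
      rw [this, sub_mulVec, map_sub]
      abel
    have n1 : ‖(T - u k).1 (D.embed j m g)‖ ≤ ‖T - u k‖ * (√(Fintype.card Ω) * ‖g‖) :=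
      ((T - u k).1.le_opNorm _).trans
        (mul_le_mul_of_nonneg_left (D.norm_embed_le_norm j m g) (norm_nonneg (T - u k)))
    have n2 : ‖D.embed j m ((f k - F) *ᵥ g)‖ ≤
        √(Fintype.card Ω) * ((∑ i, ∑ l, ‖(f k - F) i l‖) * ‖g‖) :=
      (D.norm_embed_le_norm j m _).trans
        (mul_le_mul_of_nonneg_left (norm_mulVec_le _ g) (Real.sqrt_nonneg _))
    rw [e]
    have n3 := norm_add₃_le (a := (T - u k).1 (D.embed j m g))
      (b := D.embed j m ((f k - F) *ᵥ g))
      (c := (u k).1 (D.embed j m g) - D.embed j m (f k *ᵥ g))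
    linarith
  refine ⟨of F, key hlim hF hf, key ((continuous_star.tendsto T).comp hlim) (fun i l => ?_) hfs⟩
  exact (continuous_star.tendsto _).comp (hF l i)

/-- A nonzero unit `(i, j)` of high degree is the constant function in the coordinate `i`, moved by
as many steps as its index. -/
theorem tendsto_norm_apply_unit {T : Adjointable (Ω → ℂ) (Fock P)} (hT : D.HasSymbol T 0)
    (i j : Ω) : Tendsto (fun n => ‖T.1 (unit P n i j)‖) atTop (𝓝 0) := by
  refine Metric.tendsto_nhds.2 fun ε hε => ?_
  have h1 := hT j (Pi.single i (fourier 0))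
  simp only [zero_mulVec, map_zero, sub_zero] at h1
  have h2 := (Metric.tendsto_nhds.1 h1 ε hε).and (D.embed_single_fourier j i 0)
  obtain ⟨M, hM⟩ := eventually_atTop.1 h2
  filter_upwards [eventually_ge_atTop (D.period * M + (D.phase i - D.phase j)).toNat] with n hn
  rw [Real.dist_0_eq_abs, abs_norm]
  by_cases hp : 0 < ((P : Matrix Ω Ω ℝ) ^ n) i j
  · have hle : (M : ℤ) ≤ D.index i j n := by
      refine le_of_mul_le_mul_left (a := (D.period : ℤ)) ?_ (by exact_mod_cast D.period_pos)
      rw [D.period_mul_index hp]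
      omega
    obtain ⟨m, hm⟩ := Int.eq_ofNat_of_zero_le ((Int.natCast_nonneg M).trans hle)
    obtain ⟨h3, h4⟩ := hM m (by omega)
    rw [add_zero, ← hm, D.degree_index hp] at h4
    rw [h4, dist_zero_right] at h3
    exact h3
  · rw [unit_eq_zero hp, map_zero, norm_zero]
    exact hε

theorem proj_apply_eq_sum (n : ℕ) (x : Fock P) :
    (proj n).1 x = ∑ i, ∑ j, x.comp n i j • unit P n i j := by
  ext k i' j'
  simp only [comp_sum, Matrix.sum_apply, comp_smul, Matrix.smul_apply, comp_unit, comp_proj]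
  rw [Finset.sum_eq_single i', Finset.sum_eq_single j']
  · by_cases hk : k = n
    · subst hk
      by_cases hp : 0 < ((P : Matrix Ω Ω ℝ) ^ k) i' j'
      · simp [hp]
      · simp [hp, x.comp_mem k i' j' hp]
    · simp [hk]
  · intro j _ hj
    simp [hj.symm]
  · simp
  · intro i _ hi
    simp [hi.symm]
  · simp

theorem norm_comp_apply_le (x : Fock P) (n : ℕ) (i j : Ω) : ‖x.comp n i j‖ ≤ ‖x‖ := by
  refine le_of_sq_le_sq ?_ (norm_nonneg x)
  refine le_trans ?_ ((norm_le_iff x (norm_nonneg x)).1 le_rfl j)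
  refine le_trans ?_ ((x.summable_colSq j).le_tsum n fun _ _ => colSq_nonneg _ _)
  exact Finset.single_le_sum (f := fun i => ‖x.comp n i j‖ ^ 2) (fun _ _ => by positivity)
    (Finset.mem_univ i)

/-- The number of units in a fibre is bounded independently of `n`, so smallness on units is
smallness in norm. -/
theorem norm_mul_proj_le (T : Adjointable (Ω → ℂ) (Fock P)) (n : ℕ) :
    ‖T * proj n‖ ≤ ∑ i, ∑ j, ‖T.1 (unit P n i j)‖ := by
  refine ContinuousLinearMap.opNorm_le_bound _ (by positivity) fun x => ?_
  change ‖T.1 ((proj n).1 x)‖ ≤ _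
  rw [proj_apply_eq_sum]
  simp only [map_sum, map_smul, Finset.sum_mul]
  refine norm_sum_le_of_le _ fun i _ => norm_sum_le_of_le _ fun j _ => ?_
  rw [norm_smul, mul_comm]
  exact mul_le_mul_of_nonneg_left (norm_comp_apply_le x n i j) (norm_nonneg _)

/-- The operators with a symbol which vanish in high degrees are those whose symbol is `0`. -/
theorem HasSymbol.mem_vanishing_iff {T : Adjointable (Ω → ℂ) (Fock P)}
    {f : Matrix Ω Ω C(UnitAddCircle, ℂ)} (hT : D.HasSymbol T f) : T ∈ vanishing P ↔ f = 0 := by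
  constructor
  · intro hv
    refine hT.unique (hasSymbol_of_fourier fun j l t => ?_)
    have h1 : Tendsto (fun m : ℕ => ‖T * proj (D.degree l j (m + t))‖) atTop (𝓝 0) :=
      Tendsto.comp (g := fun n => ‖T * proj n‖) hv
        ((D.tendsto_degree l j).comp (tendsto_natCast_add t))
    refine squeeze_zero_norm' ?_ h1
    filter_upwards [D.embed_single_fourier j l t] with m hm
    rw [zero_mulVec, map_zero, sub_zero, hm]
    set n := D.degree l j (m + t)
    have h2 : (proj n).1 (unit P n l j) = unit P n l j := by
      ext k i' j'
      rw [comp_proj]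
      by_cases hk : k = n
      · rw [if_pos hk]
      · simp [hk, comp_unit]
    have h3 : ‖(T * proj n).1 (unit P n l j)‖ ≤ ‖T * proj n‖ * 1 :=
      (ContinuousLinearMap.le_opNorm _ _).trans
        (mul_le_mul_of_nonneg_left (norm_unit_le n l j) (norm_nonneg _))
    rwa [Adjointable.mul_apply, h2, mul_one] at h3
  · rintro rfl
    refine squeeze_zero (fun n => norm_nonneg _) (fun n => norm_mul_proj_le T n) ?_
    have : Tendsto (fun n => ∑ i, ∑ j, ‖T.1 (unit P n i j)‖) atTop
        (𝓝 (∑ i : Ω, ∑ j : Ω, (0 : ℝ))) :=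
      tendsto_finsetSum _ fun i _ => tendsto_finsetSum _ fun j _ => tendsto_norm_apply_unit hT i j
    simpa using this

end CyclicStructure
end StochasticMatrix

/-! ### Symbols of the generators -/

namespace StochasticMatrix

open CStarModule Matrix Fock AddCircle MeasureTheory

variable {Ω : Type*} [Fintype Ω] [DecidableEq Ω] {P : rowStochastic ℝ Ω}

namespace Fock

theorem coeff_eq_zero_of_add {n m : ℕ} {i l j : Ω}
    (h : ¬ 0 < ((P : Matrix Ω Ω ℝ) ^ (n + m)) i j) : coeff P n m i l j = 0 := by
  rw [coeff_def, if_neg (by rwa [Real.sqrt_pos]), zero_mul]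

theorem shift_unit (n : ℕ) (A : Arv P n) {k : ℕ} {l j : Ω}
    (h : 0 < ((P : Matrix Ω Ω ℝ) ^ k) l j) : (shift n A).1 (unit P k l j) =
      ∑ i, ((coeff P n k i l j : ℂ) * A.1 i l) • unit P (n + k) i j := by
  ext k' i' j'
  simp only [comp_sum, Matrix.sum_apply, comp_smul, Matrix.smul_apply, comp_unit]
  rcases lt_or_ge k' n with hk | hk
  · rw [comp_shift_of_lt n A _ hk]
    have : k' ≠ n + k := by omega
    simp [this]
  · obtain ⟨m, rfl⟩ := Nat.exists_eq_add_of_le hk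
    rw [comp_shift_add, subproductMul_apply, Finset.sum_eq_single l, Finset.sum_eq_single i']
    · by_cases hm : m = k
      · subst hm
        by_cases hj : j' = j
        · subst hj
          by_cases hp : 0 < ((P : Matrix Ω Ω ℝ) ^ (n + m)) i' j'
          · simp [comp_unit, h, hp]
          · simp [comp_unit, hp, coeff_eq_zero_of_add hp]
        · simp [comp_unit, hj]
      · simp [comp_unit, hm]
    · intro i _ hi
      simp [hi.symm]
    · simp
    · intro l' _ hl
      simp [comp_unit, hl]
    · simp

theorem star_shift (n : ℕ) (A : Arv P n) :
    (star (shift n A)).1 = ofSeq (shiftAdjSeq n A) (isBounded_shiftAdjSeq n A) :=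
  Adjointable.star_eq fun x y => by
    rw [inner_def, inner_def, ← (summable_fibreInner _ _).sum_add_tsum_nat_add n,
      Finset.sum_eq_zero, zero_add]
    · refine tsum_congr fun k => ?_
      rw [add_comm k n, comp_shift_add, fibreInner_subproductMul]
      rfl
    · intro k hk
      simp [comp_shift_of_lt n A x (Finset.mem_range.1 hk), fibreInner]

theorem comp_star_shift (n : ℕ) (A : Arv P n) (x : Fock P) (m : ℕ) :
    ((star (shift n A)).1 x).comp m = subproductAdj P n m A.1 (x.comp (n + m)) := by
  rw [star_shift]
  rfl

theorem star_shift_unit (n : ℕ) (A : Arv P n) {k : ℕ} {i j : Ω}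
    (h : 0 < ((P : Matrix Ω Ω ℝ) ^ (n + k)) i j) : (star (shift n A)).1 (unit P (n + k) i j) =
      ∑ l, ((coeff P n k i l j : ℂ) * star (A.1 i l)) • unit P k l j := by
  ext m l' j'
  simp only [comp_sum, Matrix.sum_apply, comp_smul, Matrix.smul_apply, comp_unit]
  rw [comp_star_shift, subproductAdj, of_apply, Finset.sum_eq_single i, Finset.sum_eq_single l']
  · by_cases hm : m = k
    · subst hm
      by_cases hj : j' = j
      · subst hj
        by_cases hp : 0 < ((P : Matrix Ω Ω ℝ) ^ m) l' j'
        · simp [comp_unit, h, hp]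
        · simp [comp_unit, hp, coeff_eq_zero hp]
      · simp [comp_unit, hj]
    · simp [comp_unit, hm]
  · intro l _ hl
    simp [hl.symm]
  · simp
  · intro i' _ hi
    simp [comp_unit, hi]
  · simp

theorem leftAction_unit (a : Ω → ℂ) (k : ℕ) (l j : Ω) :
    (leftAction a).1 (unit P k l j) = a l • unit P k l j := by
  ext m i j'
  simp only [comp_leftAction, diagonal_mul, comp_smul, Matrix.smul_apply, comp_unit, smul_eq_mul]
  split_ifs with h
  · rw [h.2.2.1]
  · simp

theorem star_leftAction (a : Ω → ℂ) :
    star (leftAction a : Adjointable (Ω → ℂ) (Fock P)) = leftAction (star a) :=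
  Subtype.ext <| Adjointable.star_eq fun x y => by
    rw [inner_def, inner_def]
    refine tsum_congr fun k => funext fun j => ?_
    simp only [fibreInner_apply, comp_leftAction, diagonal_mul, star_mul', Pi.star_apply]
    exact Finset.sum_congr rfl fun i _ => by ring

end Fock

namespace CyclicStructure

variable (D : CyclicStructure P)

/-- The symbol of an operator of degree `d` with the coefficients `c`. -/
noncomputable def bandSymbol (d : ℤ) (c : Matrix Ω Ω ℂ) : Matrix Ω Ω C(UnitAddCircle, ℂ) :=
  of fun i l => c i l • fourier ((d + D.phase l - D.phase i) / D.period)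

/-- The divisibility is needed because integer division rounds, and only exact quotients change sign
with the numerator. -/
theorem star_bandSymbol {d : ℤ} {c : Matrix Ω Ω ℂ}
    (hc : ∀ i l, c i l ≠ 0 → (D.period : ℤ) ∣ d + D.phase l - D.phase i) :
    star (D.bandSymbol d c) = D.bandSymbol (-d) (star c) := by
  ext i l x
  simp only [star_apply, bandSymbol, of_apply, ContinuousMap.star_apply, ContinuousMap.smul_apply,
    star_smul]
  by_cases h : c l i = 0
  · simp [h]
  · have : (-d + D.phase l - D.phase i) / D.period = -((d + D.phase i - D.phase l) / D.period) := by
      rw [← Int.neg_ediv_of_dvd (hc l i h)]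
      congr 1
      ring
    rw [this, fourier_neg]
    rfl

/-- Passing from `(l, j)` in degree `n` to `(i, j)` in degree `n + d` raises the index by `(d +
phase l - phase i) / r`. The phase of `j` cancels, so one symbol fits all columns. -/
theorem hasSymbol_bandSymbol {T : Adjointable (Ω → ℂ) (Fock P)} {d : ℤ} {c : Matrix Ω Ω ℂ}
    (hc : ∀ i l, c i l ≠ 0 → (D.period : ℤ) ∣ d + D.phase l - D.phase i)
    (hT : ∀ j l, Tendsto (fun t : ℤ => T.1 (unit P (D.degree l j t) l j) -
      ∑ i, c i l • unit P ((D.degree l j t : ℤ) + d).toNat i j) atTop (𝓝 0)) :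
    D.HasSymbol T (D.bandSymbol d c) := by
  refine hasSymbol_of_fourier fun j l t => ?_
  refine ((hT j l).comp (tendsto_natCast_add t)).congr' ?_
  have h1 : ∀ᶠ m : ℕ in atTop, ∀ i,
      D.embed j m (Pi.single i (fourier ((d + D.phase l - D.phase i) / D.period + t))) =
        unit P (D.degree i j (m + ((d + D.phase l - D.phase i) / D.period + t))) i j :=
    eventually_all.2 fun i => D.embed_single_fourier j i _
  filter_upwards [h1, D.embed_single_fourier j l t,
    (tendsto_natCast_add t).eventually (D.eventually_degree l j)] with m hm1 hm2 hm3
  have h2 : D.bandSymbol d c *ᵥ Pi.single l (fourier t) = ∑ i, c i l •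
      (Pi.single i (fourier ((d + D.phase l - D.phase i) / D.period + t)) :
        Ω → C(UnitAddCircle, ℂ)) := by
    ext i x
    rw [mulVec_single, Finset.sum_apply, Finset.sum_eq_single i]
    · simp only [bandSymbol, Pi.smul_apply, op_smul_eq_mul, col_apply, of_apply,
        ContinuousMap.mul_apply, ContinuousMap.smul_apply, Pi.single_eq_same, fourier_add,
        smul_mul_assoc]
    · intro i' _ hi
      rw [Pi.smul_apply, Pi.single_eq_of_ne hi.symm]
      exact smul_zero (A := C(UnitAddCircle, ℂ)) (c i' l)
    · simp
  rw [h2, map_sum, hm2]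
  simp only [Function.comp_apply, map_smul, hm1]
  congr 1
  refine Finset.sum_congr rfl fun i _ => ?_
  by_cases h : c i l = 0
  · simp [h]
  · congr 2
    have := Int.mul_ediv_cancel' (hc i l h)
    rw [hm3.1, degree]
    congr 1
    linear_combination -this

theorem tendsto_sum_smul_sub {ι E α : Type*} [Fintype ι] [SeminormedAddCommGroup E]
    [NormedSpace ℂ E] {F : Filter α} {c : α → ι → ℂ} {c' : ι → ℂ} {x : α → ι → E}
    (hc : ∀ i, Tendsto (fun t => c t i) F (𝓝 (c' i))) (hx : ∀ t i, ‖x t i‖ ≤ 1) :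
    Tendsto (fun t => ∑ i, c t i • x t i - ∑ i, c' i • x t i) F (𝓝 0) := by
  have h : Tendsto (fun t => ∑ i, ‖c t i - c' i‖) F (𝓝 (∑ i : ι, (0 : ℝ))) :=
    tendsto_finsetSum _ fun i _ => by simpa using ((hc i).sub_const (c' i)).norm
  rw [Finset.sum_const_zero] at h
  refine squeeze_zero_norm (fun t => ?_) h
  rw [← Finset.sum_sub_distrib]
  refine norm_sum_le_of_le _ fun i _ => ?_
  rw [← sub_smul, norm_smul]
  exact mul_le_of_le_one_right (norm_nonneg _) (hx t i)

variable (P) in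
/-- The limit of the coefficients of the shift by `A`. -/
noncomputable def shiftLimit (n : ℕ) (A : Matrix Ω Ω ℂ) : Matrix Ω Ω ℂ :=
  of fun i l => (√(((P : Matrix Ω Ω ℝ) ^ n) i l) : ℂ) * A i l

theorem dvd_of_shiftLimit_ne_zero {n : ℕ} {A : Matrix Ω Ω ℂ} {i l : Ω}
    (h : shiftLimit P n A i l ≠ 0) : (D.period : ℤ) ∣ n + D.phase l - D.phase i := by
  refine D.dvd_of_pos (lt_of_not_ge fun h0 => h ?_)
  simp [shiftLimit, Real.sqrt_eq_zero_of_nonpos h0]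

theorem hasSymbol_shift (n : ℕ) (A : Arv P n) :
    D.HasSymbol (shift n A) (D.bandSymbol n (shiftLimit P n A)) := by
  refine D.hasSymbol_bandSymbol (fun i l => D.dvd_of_shiftLimit_ne_zero) fun j l => ?_
  have hdeg : Tendsto (D.degree l j) atTop
      (atTop ⊓ 𝓟 {k | 0 < ((P : Matrix Ω Ω ℝ) ^ k) l j}) :=
    tendsto_inf.2 ⟨D.tendsto_degree l j,
      tendsto_principal.2 ((D.eventually_degree l j).mono fun t ht => ht.2)⟩
  refine (tendsto_sum_smul_sub (x := fun t i => unit P (n + D.degree l j t) i j)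
    (fun i => (((Complex.continuous_ofReal.tendsto _).comp
      (D.tendsto_coeff n i l j)).comp hdeg).mul_const (A.1 i l))
    fun t i => norm_unit_le _ _ _).congr' ?_
  filter_upwards [D.eventually_degree l j] with t ht
  rw [shift_unit n A ht.2, show ((D.degree l j t : ℤ) + n).toNat = n + D.degree l j t by omega]
  rfl

theorem hasSymbol_star_shift (n : ℕ) (A : Arv P n) :
    D.HasSymbol (star (shift n A)) (star (D.bandSymbol n (shiftLimit P n A))) := by
  rw [D.star_bandSymbol (c := shiftLimit P n A) fun i l => D.dvd_of_shiftLimit_ne_zero]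
  refine D.hasSymbol_bandSymbol (fun l i h => ?_) fun j i => ?_
  · obtain ⟨x, hx⟩ := D.dvd_of_shiftLimit_ne_zero (n := n) (A := A.1) (i := i) (l := l) fun h0 =>
      h (by rw [star_apply, h0, star_zero])
    exact ⟨-x, by linear_combination -hx⟩
  -- The adjoint lowers the degree by `n`, so the coefficients are taken at `degree - n`. Their
  -- limit needs `(l, j)` in the support of that power, which holds eventually if `(P ^ n) i l > 0`;
  -- otherwise the coefficient vanishes.
  have hdeg : Tendsto (fun t => D.degree i j t - n) atTop atTop :=
    (tendsto_sub_atTop_nat n).comp (D.tendsto_degree i j)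
  have hcoeff : ∀ l, Tendsto (fun t => coeff P n (D.degree i j t - n) i l j) atTop
      (𝓝 √(((P : Matrix Ω Ω ℝ) ^ n) i l)) := by
    intro l
    rcases (pow_nonneg_apply P n i l).eq_or_lt with h0 | h0
    · have : ∀ k, coeff P n k i l j = 0 := fun k => by simp [coeff_def, ← h0]
      simp [this, ← h0]
    · refine (D.tendsto_coeff n i l j).comp (tendsto_inf.2 ⟨hdeg, tendsto_principal.2 ?_⟩)
      filter_upwards [D.eventually_degree i j, (D.tendsto_degree i j).eventually_ge_atTop
        (n + D.bound)] with t ht hb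
      refine D.pos_of_pos_add (by omega) ?_ h0
      rw [Nat.add_sub_cancel' (by omega)]
      exact ht.2
  refine (tendsto_sum_smul_sub (x := fun t l => unit P (D.degree i j t - n) l j)
    (fun l => ((Complex.continuous_ofReal.tendsto _).comp (hcoeff l)).mul_const (star (A.1 i l)))
    fun t l => norm_unit_le _ _ _).congr' ?_
  filter_upwards [D.eventually_degree i j, (D.tendsto_degree i j).eventually_ge_atTop n]
    with t ht hn
  have hu := star_shift_unit n A (k := D.degree i j t - n) (i := i) (j := j)
    (by rw [Nat.add_sub_cancel' hn]; exact ht.2)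
  rw [Nat.add_sub_cancel' hn] at hu
  rw [hu, show ((D.degree i j t : ℤ) + -n).toNat = D.degree i j t - n by omega]
  simp [shiftLimit]

theorem hasSymbol_leftAction (a : Ω → ℂ) :
    D.HasSymbol (leftAction a) (D.bandSymbol 0 (diagonal a)) := by
  refine D.hasSymbol_bandSymbol (fun i l h => ?_) fun j l => ?_
  · obtain rfl : i = l := by
      by_contra hil
      exact h (diagonal_apply_ne _ hil)
    simp
  · refine tendsto_const_nhds.congr fun t => ?_
    rw [leftAction_unit, Finset.sum_eq_single l]
    · simp
    · intro i _ hi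
      rw [diagonal_apply_ne _ hi, zero_smul]
    · simp

theorem hasSymbol_star_leftAction (a : Ω → ℂ) :
    D.HasSymbol (star (leftAction a)) (star (D.bandSymbol 0 (diagonal a))) := by
  rw [star_leftAction, D.star_bandSymbol, neg_zero, star_eq_conjTranspose, diagonal_conjTranspose]
  · exact D.hasSymbol_leftAction (star a)
  · intro i l h
    obtain rfl : i = l := by
      by_contra hil
      exact h (diagonal_apply_ne _ hil)
    simp

/-- The operators with a symbol such that the adjoint has the adjoint symbol. -/
noncomputable def symbolic : StarSubalgebra ℂ (Adjointable (Ω → ℂ) (Fock P)) where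
  carrier := {T | ∃ f, D.HasSymbol T f ∧ D.HasSymbol (star T) (star f)}
  mul_mem' := by
    rintro S T ⟨e, he, he'⟩ ⟨f, hf, hf'⟩
    exact ⟨e * f, he.mul hf, by
      rw [star_mul, star_eq_conjTranspose, conjTranspose_mul]; exact hf'.mul he'⟩
  add_mem' := by
    rintro S T ⟨e, he, he'⟩ ⟨f, hf, hf'⟩
    exact ⟨e + f, he.add hf, by rw [star_add, star_add]; exact he'.add hf'⟩
  algebraMap_mem' z := ⟨algebraMap ℂ _ z, .algebraMap z, by
    rw [← algebraMap_star_comm, ← algebraMap_star_comm]; exact .algebraMap _⟩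
  star_mem' := by
    rintro T ⟨f, hf, hf'⟩
    exact ⟨star f, hf', by rwa [star_star, star_star]⟩

theorem toeplitz_le_symbolic : Toeplitz P ≤ D.symbolic := by
  refine StarSubalgebra.topologicalClosure_minimal (StarAlgebra.adjoin_le ?_)
    isClosed_setOf_hasSymbol
  rintro _ (⟨a, rfl⟩ | ⟨n, A, rfl⟩)
  · exact ⟨_, D.hasSymbol_leftAction a, D.hasSymbol_star_leftAction a⟩
  · exact ⟨_, D.hasSymbol_shift n A, D.hasSymbol_star_shift n A⟩

end CyclicStructure
end StochasticMatrix

/-! ### The symbol homomorphism and its range -/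

namespace StochasticMatrix

open CStarModule Matrix Fock AddCircle MeasureTheory

variable {Ω : Type*} [Fintype Ω] [DecidableEq Ω] {P : rowStochastic ℝ Ω}

namespace CyclicStructure

variable (D : CyclicStructure P)

/-- The symbol of an operator of the Toeplitz algebra. -/
noncomputable def symbol (T : Toeplitz P) : Matrix Ω Ω C(UnitAddCircle, ℂ) :=
  (D.toeplitz_le_symbolic T.2).choose

theorem hasSymbol_symbol (T : Toeplitz P) : D.HasSymbol T (D.symbol T) :=
  (D.toeplitz_le_symbolic T.2).choose_spec.1

theorem hasSymbol_star_symbol (T : Toeplitz P) : D.HasSymbol (star T.1) (star (D.symbol T)) :=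
  (D.toeplitz_le_symbolic T.2).choose_spec.2

theorem symbol_eq {T : Toeplitz P} {f : Matrix Ω Ω C(UnitAddCircle, ℂ)}
    (h : D.HasSymbol T.1 f) : D.symbol T = f := (D.hasSymbol_symbol T).unique h

theorem symbol_zero : D.symbol 0 = 0 := D.symbol_eq (by rw [ZeroMemClass.coe_zero]; exact .zero)

theorem symbol_one : D.symbol 1 = 1 := D.symbol_eq (by rw [OneMemClass.coe_one]; exact .one)

theorem symbol_add (S T : Toeplitz P) : D.symbol (S + T) = D.symbol S + D.symbol T :=
  D.symbol_eq ((D.hasSymbol_symbol S).add (D.hasSymbol_symbol T))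

theorem symbol_mul (S T : Toeplitz P) : D.symbol (S * T) = D.symbol S * D.symbol T :=
  D.symbol_eq ((D.hasSymbol_symbol S).mul (D.hasSymbol_symbol T))

theorem symbol_algebraMap (z : ℂ) :
    D.symbol (algebraMap ℂ (Toeplitz P) z) = algebraMap ℂ _ z :=
  D.symbol_eq (T := algebraMap ℂ (Toeplitz P) z) (HasSymbol.algebraMap z)

theorem symbol_star (T : Toeplitz P) : D.symbol (star T) = star (D.symbol T) :=
  D.symbol_eq (D.hasSymbol_star_symbol T)

/-- The symbol map of the Toeplitz algebra. -/
noncomputable def symbolHom : Toeplitz P →⋆ₐ[ℂ] CStarMatrix Ω Ω C(UnitAddCircle, ℂ) where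
  toFun T := CStarMatrix.ofMatrix (D.symbol T)
  map_one' := congrArg CStarMatrix.ofMatrix D.symbol_one
  map_zero' := congrArg CStarMatrix.ofMatrix D.symbol_zero
  map_mul' S T := congrArg CStarMatrix.ofMatrix (D.symbol_mul S T)
  map_add' S T := congrArg CStarMatrix.ofMatrix (D.symbol_add S T)
  commutes' z := congrArg CStarMatrix.ofMatrix (D.symbol_algebraMap z)
  map_star' T := congrArg CStarMatrix.ofMatrix (D.symbol_star T)

theorem symbolHom_eq {T : Toeplitz P} {f : Matrix Ω Ω C(UnitAddCircle, ℂ)}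
    (h : D.HasSymbol T.1 f) : D.symbolHom T = CStarMatrix.ofMatrix f :=
  congrArg CStarMatrix.ofMatrix (D.symbol_eq h)

theorem symbolHom_eq_zero_iff (T : Toeplitz P) : D.symbolHom T = 0 ↔ T ∈ cuntzPimsnerIdeal P :=
  (D.hasSymbol_symbol T).mem_vanishing_iff.symm

/-- The codomain `CStarMatrix` carries a C⋆-norm, so the general result on ranges of ⋆-homomorphisms
applies. -/
theorem isClosed_range_symbolHom : IsClosed (Set.range D.symbolHom) := by
  have : IsClosed (Toeplitz P : Set (Adjointable (Ω → ℂ) (Fock P))) :=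
    StarSubalgebra.isClosed_topologicalClosure _
  let _ : CStarAlgebra (Toeplitz P) := StarSubalgebra.cstarAlgebra (Toeplitz P)
  exact StarAlgHom.isClosed_range D.symbolHom

/-- The matrix whose only entry is a Fourier monomial. -/
noncomputable def singleFourier {Ω : Type*} [DecidableEq Ω] (i l : Ω) (t : ℤ) :
    CStarMatrix Ω Ω C(UnitAddCircle, ℂ) :=
  CStarMatrix.ofMatrix (Matrix.single i l (fourier t))

theorem singleFourier_mul (i l k : Ω) (s t : ℤ) :
    singleFourier i l s * singleFourier l k t = singleFourier i k (s + t) := by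
  have h : (fourier s * fourier t : C(UnitAddCircle, ℂ)) = fourier (s + t) := by
    ext x
    exact fourier_add.symm
  exact congrArg CStarMatrix.ofMatrix ((single_mul_single_same ..).trans (by rw [h]))

theorem star_singleFourier {Ω : Type*} [DecidableEq Ω] (i l : Ω) (t : ℤ) :
    star (singleFourier i l t) = singleFourier l i (-t) := by
  have h : star (fourier t : C(UnitAddCircle, ℂ)) = fourier (-t) := by
    ext x
    exact fourier_neg.symm
  have h' : (Matrix.single i l (fourier t : C(UnitAddCircle, ℂ)))ᴴ =
      Matrix.single l i (fourier (-t)) := by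
    rw [conjTranspose_single, h]
  exact congrArg CStarMatrix.ofMatrix h'

/-- The inverse square root is chosen to cancel the limit of the coefficients. -/
theorem bandSymbol_shiftLimit_single {n : ℕ} {i l : Ω} (h : 0 < ((P : Matrix Ω Ω ℝ) ^ n) i l) :
    D.bandSymbol n
      (shiftLimit P n (Matrix.single i l (√(((P : Matrix Ω Ω ℝ) ^ n) i l) : ℂ)⁻¹)) =
      Matrix.single i l (fourier (D.index i l n)) := by
  ext1 i' l'
  simp only [bandSymbol, shiftLimit, of_apply]
  by_cases hh : i = i' ∧ l = l'
  · obtain ⟨rfl, rfl⟩ := hh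
    have : (√(((P : Matrix Ω Ω ℝ) ^ n) i l) : ℂ) ≠ 0 := by
      exact_mod_cast (Real.sqrt_pos.2 h).ne'
    rw [single_apply_same, single_apply_same, mul_inv_cancel₀ this, one_smul]
    rfl
  · rw [single_apply_of_ne _ _ _ _ _ hh, single_apply_of_ne _ _ _ _ _ hh, mul_zero]
    exact zero_smul ℂ (fourier _ : C(UnitAddCircle, ℂ))

theorem shift_mem_toeplitz (n : ℕ) (A : Arv P n) : shift n A ∈ Toeplitz P :=
  StarSubalgebra.le_topologicalClosure _ (StarAlgebra.subset_adjoin ℂ _ (.inr ⟨n, A, rfl⟩))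

theorem symbolHom_shift (n : ℕ) (A : Arv P n) :
    D.symbolHom ⟨shift n A, shift_mem_toeplitz n A⟩ =
      CStarMatrix.ofMatrix (D.bandSymbol n (shiftLimit P n A.1)) :=
  D.symbolHom_eq (D.hasSymbol_shift n A)

theorem exists_symbolHom_eq_of_pos {n : ℕ} {i l : Ω} (h : 0 < ((P : Matrix Ω Ω ℝ) ^ n) i l) :
    ∃ T, D.symbolHom T = singleFourier i l (D.index i l n) := by
  have hA : Matrix.single i l (√(((P : Matrix Ω Ω ℝ) ^ n) i l) : ℂ)⁻¹ ∈ Arv P n := by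
    intro i' l' h'
    refine single_apply_of_ne _ _ _ _ _ ?_
    rintro ⟨rfl, rfl⟩
    exact h' h
  exact ⟨_, (D.symbolHom_shift n ⟨_, hA⟩).trans
    (congrArg CStarMatrix.ofMatrix (D.bandSymbol_shiftLimit_single h))⟩

theorem exists_symbolHom_eq_singleFourier (i l : Ω) (t : ℤ) :
    ∃ T, D.symbolHom T = singleFourier i l t := by
  have key : ∀ i l, ∀ᶠ s in atTop, ∃ T, D.symbolHom T = singleFourier i l s := fun i l => by
    filter_upwards [D.eventually_degree i l] with s hs
    have := D.exists_symbolHom_eq_of_pos hs.2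
    rwa [D.index_degree hs.1] at this
  -- Shifts only give large exponents. For large `s`, both `t + s` at `(i, l)` and `s` at `(l, l)`
  -- occur, and the first times the adjoint of the second has exponent `t`.
  obtain ⟨s, ⟨S, hS⟩, T, hT⟩ := (((tendsto_atTop_add_const_left atTop t tendsto_id).eventually
    (key i l)).and (key l l)).exists
  refine ⟨S * star T, ?_⟩
  rw [map_mul, map_star, hS, hT, star_singleFourier, singleFourier_mul, id, add_neg_cancel_right]

/-- The range is a closed subspace, so in each entry it suffices to reach the Fourier monomials,
whose span is dense in the continuous functions. -/
theorem symbolHom_surjective : Function.Surjective D.symbolHom := by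
  let K : Submodule ℂ (CStarMatrix Ω Ω C(UnitAddCircle, ℂ)) :=
    LinearMap.range D.symbolHom.toAlgHom.toLinearMap
  have hK : IsClosed (K : Set (CStarMatrix Ω Ω C(UnitAddCircle, ℂ))) := D.isClosed_range_symbolHom
  have hsingle : ∀ i l (φ : C(UnitAddCircle, ℂ)),
      CStarMatrix.ofMatrix (Matrix.single i l φ) ∈ K := by
    intro i l φ
    let s : C(UnitAddCircle, ℂ) →ₗ[ℂ] CStarMatrix Ω Ω C(UnitAddCircle, ℂ) :=
      CStarMatrix.ofMatrixL.toLinearMap ∘ₗ singleLinearMap ℂ i l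
    have hsc : Continuous fun φ : C(UnitAddCircle, ℂ) => Matrix.single i l φ :=
      continuous_matrix fun i' l' => by
        by_cases h : i = i' ∧ l = l'
        · obtain ⟨rfl, rfl⟩ := h
          simpa only [single_apply_same] using continuous_id'
        · simpa only [single_apply_of_ne _ _ _ _ _ h] using continuous_const
    have hs : Continuous s := CStarMatrix.ofMatrixL.continuous.comp hsc
    have : (⊤ : Submodule ℂ C(UnitAddCircle, ℂ)) ≤ K.comap s := by
      rw [← span_fourier_closure_eq_top]
      refine Submodule.topologicalClosure_minimal _ (Submodule.span_le.2 ?_) (hK.preimage hs)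
      rintro _ ⟨t, rfl⟩
      exact D.exists_symbolHom_eq_singleFourier i l t
    exact this (Submodule.mem_top (x := φ))
  intro f
  have hf : CStarMatrix.ofMatrix (∑ i, ∑ l, Matrix.single i l (CStarMatrix.ofMatrix.symm f i l)) ∈
      K := by
    have : CStarMatrix.ofMatrixL (∑ i, ∑ l, Matrix.single i l (CStarMatrix.ofMatrix.symm f i l)) ∈
        K := by
      simp only [map_sum]
      exact K.sum_mem fun i _ => K.sum_mem fun l _ => hsingle i l _
    exact this
  rw [← matrix_eq_sum_single] at hf
  exact hf

/-- The Cuntz–Pimsner algebra is the algebra of the symbols. -/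
noncomputable def cuntzPimsnerEquiv :
    CuntzPimsner P ≃⋆ₐ[ℂ] Matrix Ω Ω C(UnitAddCircle, ℂ) :=
  let φ : CuntzPimsner P →+* Matrix Ω Ω C(UnitAddCircle, ℂ) :=
    Ideal.Quotient.lift (cuntzPimsnerIdeal P)
      ((CStarMatrix.ofMatrixRingEquiv.symm : _ ≃+* Matrix Ω Ω C(UnitAddCircle, ℂ)).toRingHom.comp
        D.symbolHom.toAlgHom.toRingHom) fun T hT => (D.symbolHom_eq_zero_iff T).2 hT
  have hφ : Function.Bijective φ := by
    refine ⟨(injective_iff_map_eq_zero φ).2 fun x hx => ?_, fun f => ?_⟩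
    · obtain ⟨T, rfl⟩ := Ideal.Quotient.mk_surjective x
      exact Ideal.Quotient.eq_zero_iff_mem.2 ((D.symbolHom_eq_zero_iff T).1 hx)
    · obtain ⟨T, hT⟩ := D.symbolHom_surjective (CStarMatrix.ofMatrix f)
      exact ⟨Ideal.Quotient.mk _ T, hT⟩
  { RingEquiv.ofBijective φ hφ with
    map_star' := fun x => by
      obtain ⟨T, rfl⟩ := Ideal.Quotient.mk_surjective x
      exact map_star D.symbolHom T
    map_smul' := fun z x => by
      obtain ⟨T, rfl⟩ := Ideal.Quotient.mk_surjective x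
      exact map_smul D.symbolHom z T }

end CyclicStructure

/-! ### The tensor product and the conclusion -/

/-- Matrices of functions on the circle as a tensor product. -/
noncomputable def matrixTensorEquiv {d : ℕ} (e : Ω ≃ Fin d) :
    Matrix Ω Ω C(UnitAddCircle, ℂ) ≃⋆ₐ[ℂ] Matrix (Fin d) (Fin d) ℂ ⊗[ℂ] C(Circle, ℂ) :=
  let h : UnitAddCircle ≃ₜ Circle := AddCircle.homeomorphCircle one_ne_zero
  let ψ : Matrix (Fin d) (Fin d) ℂ ⊗[ℂ] C(Circle, ℂ) ≃ₐ[ℂ] Matrix Ω Ω C(UnitAddCircle, ℂ) :=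
    ((Algebra.TensorProduct.comm ℂ _ _).trans (matrixEquivTensor (Fin d) ℂ C(Circle, ℂ)).symm).trans
      (((h.compStarAlgEquiv' ℂ ℂ).toAlgEquiv.mapMatrix).trans (reindexAlgEquiv ℂ _ e.symm))
  (StarAlgEquiv.ofAlgEquiv ψ fun x => by
    induction x with
    | zero => simp
    | add x y hx hy => rw [star_add, map_add, hx, hy, map_add, star_add]
    | tmul M a =>
      ext i j x
      simp [ψ, matrixEquivTensor_apply_symm]).symm

end StochasticMatrix

/-- For an irreducible stochastic matrix `P` of size `d`, the Cuntz–Pimsner algebra `𝓞(P)` is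
⋆-isomorphic to `M_d(ℂ) ⊗ C(𝕋)`. Since `M_d(ℂ)` is finite-dimensional, the algebraic tensor product
is already the C⋆-algebraic one. -/
theorem mainTheorem4 {Ω : Type*} [Fintype Ω] [DecidableEq Ω] (d : ℕ) (hd : Fintype.card Ω = d)
    (P : Matrix.rowStochastic ℝ Ω) (hP : (P : Matrix Ω Ω ℝ).IsIrreducible) :
    Nonempty (StochasticMatrix.CuntzPimsner P ≃⋆ₐ[ℂ]
      (Matrix (Fin d) (Fin d) ℂ ⊗[ℂ] C(Circle, ℂ))) := by
  obtain ⟨D⟩ := StochasticMatrix.nonempty_cyclicStructure hP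
  exact ⟨D.cuntzPimsnerEquiv.trans
    (StochasticMatrix.matrixTensorEquiv (Fintype.equivFinOfCardEq hd))⟩
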